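/- All graphs are finite and may have loops and multiple edges; a loop at $v$ contributes $2$ to the degree $d_G(v)$. A signed graph is a graph $G$ with a signature $\sigma:E(G)\to\{1,-1\}$; an edge $e$ is negative if $\sigma(e)=-1$. For $X\subseteq V(G)$, $\delta_G(X)$ denotes the set of edges with one end in $X$ and the other end in $V(G)\setminus X$. Switching at a vertex $v$ changes the sign of every edge in $\delta_G(\{v\})$. A signed graph is balanced if a sequence of switches turns it into one without negative edges, and unbalanced otherwise. Every edge $e$ consists of two half-edges $h,\hat h$, each incident with one end of $e=e_h$. An orientation is a map $\tau$ from the half-edges to $\{1,-1\}$ with $\tau(h)\tau(\hat h)=-\sigma(e_h)$ for every half-edge $h$. For an abelian group $A$, a nowhere-zero $A$-flow ($A$-NZF) is a pair $(\tau,f)$ of an orientation $\tau$ and a map $f:E(G)\to A\setminus\{0\}$ such that $\sum_{h}\tau(h)f(e_h)=0$ for every vertex $v$, the sum running over the half-edges $h$ incident with $v$. A signed graph is flow-admissible if for some positive integer $k$ it has a $\mathbb Z$-NZF $(\tau,f)$ with $|f(e)|<k$ for all edges $e$. A $\mathbb Z_2\times\mathbb Z_3$-NZF $(\tau,(f_1,f_2))$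 is balanced if the number of negative edges $e$ with $f_1(e)\neq0$ is even. For a subgraph $H$ of $G$, a chord of $H$ is an edge $e\in E(G)\setminus E(H)$ with both ends in $V(H)$, and $\mathcal U(H)$ is the set of the chords $e$ of $H$ for which $H+e$ is unbalanced. A graph is cubic if all its vertices have degree $3$. A circuit is a connected graph all of whose vertices have degree $2$. A signed graph $G$ is a shrubbery if (S1) every vertex of $G$ has degree at most $3$; (S2) every cubic signed subgraph of $G$ is flow-admissible; (S3) $|\delta_G(V(H))|+\sum_{x\in V(H)}(3-d_G(x))+2|\mathcal U(H)|\ge 4$ for every balanced and connected signed subgraph $H$ of $G$ with $|V(H)|\ge2$; (S4) $G$ contains no balanced circuit with exactly $4$ edges. **Lemma.** The following two statements are equivalent: (i) every flow-admissible signed graph admits a balanced $\mathbb Z_2\times\mathbb Z_3$-NZF; (ii) every cubic shrubbery admits a balanced $\mathbb Z_2\times\mathbb Z_3$-NZF. -/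

import Mathlib

universe u v

/-- A signed (multi)graph with vertex type `V` and edge type `E`; loops and multiple edges are
allowed. Every edge `e` is composed of the two half-edges `(e, false)` and `(e, true)`, and `vert h`
is the vertex with which the half-edge `h` is incident. `sign` is the signature. -/
structure SignedGraph (V : Type u) (E : Type v) where
  vert : E × Bool → V
  sign : E → ℤˣ

namespace SignedGraph

variable {V : Type u} {E : Type v}

/-- The half-edge `ĥ` that makes up an edge together with `h`. -/
def opp (h : E × Bool) : E × Bool := (h.1, !h.2)

open Classical in
/-- `H_G(v)`: the half-edges incident with `v`. -/
noncomputable def halfEdgesAt [Fintype E] (G : SignedGraph V E) (v : V) : Finset (E × Bool) :=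
  Finset.univ.filter fun h => G.vert h = v

/-- The degree of `v` (a loop at `v` counts twice). -/
noncomputable def degree [Fintype E] (G : SignedGraph V E) (v : V) : ℕ := (G.halfEdgesAt v).card

/-- Every vertex has degree three. -/
def IsCubic [Fintype E] (G : SignedGraph V E) : Prop := ∀ v, G.degree v = 3

/-- `δ_G(X)`: the edges with one end in `X` and the other end outside `X`. -/
def boundaryEdges (G : SignedGraph V E) (X : Set V) : Set E :=
  {e | (G.vert (e, false) ∈ X ∧ G.vert (e, true) ∉ X) ∨
       (G.vert (e, false) ∉ X ∧ G.vert (e, true) ∈ X)}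

/-- Two vertices joined by an edge. -/
def Adj (G : SignedGraph V E) (x y : V) : Prop := ∃ h : E × Bool, G.vert h = x ∧ G.vert (opp h) = y

/-- The graph is nonempty and any two vertices are joined by a walk. -/
def IsConnected (G : SignedGraph V E) : Prop :=
  Nonempty V ∧ ∀ x y : V, Relation.ReflTransGen G.Adj x y

/-! ### Switching and balance -/

open Classical in
/-- The switch at `v`: the sign of every edge in `δ_G(v)` is changed (loops at `v` keep theirs). -/
noncomputable def switch (G : SignedGraph V E) (v : V) : SignedGraph V E where
  vert := G.vert
  sign e := if e ∈ G.boundaryEdges {v} then -G.sign e else G.sign e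

/-- `G'` is obtained from `G` by a sequence of switches. -/
def SwitchEquiv (G G' : SignedGraph V E) : Prop :=
  Relation.ReflTransGen (fun G₁ G₂ => ∃ v, G₂ = G₁.switch v) G G'

/-- Equivalent to a signed graph without negative edges. -/
def IsBalanced (G : SignedGraph V E) : Prop :=
  ∃ G' : SignedGraph V E, G.SwitchEquiv G' ∧ ∀ e, G'.sign e = 1

/-! ### Flows -/

/-- An orientation: `τ h = 1` means that `h` is oriented away from its end. -/
def IsOrientation (G : SignedGraph V E) (τ : E × Bool → ℤˣ) : Prop :=
  ∀ h : E × Bool, τ h * τ (opp h) = -G.sign h.1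

/-- The boundary `∂f(v) = ∑_{h ∈ H_G(v)} τ(h) f(e_h)`. -/
noncomputable def boundary [Fintype E] {A : Type*} [AddCommGroup A] (G : SignedGraph V E)
    (τ : E × Bool → ℤˣ) (f : E → A) (v : V) : A :=
  ∑ h ∈ G.halfEdgesAt v, (τ h : ℤ) • f h.1

/-- `(τ, f)` is a nowhere-zero `A`-flow of `G`. -/
def IsNZF [Fintype E] {A : Type*} [AddCommGroup A] (G : SignedGraph V E)
    (τ : E × Bool → ℤˣ) (f : E → A) : Prop :=
  G.IsOrientation τ ∧ (∀ v, G.boundary τ f v = 0) ∧ ∀ e, f e ≠ 0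

/-- `G` admits a nowhere-zero (integer) `k`-flow for some positive integer `k`. -/
def IsFlowAdmissible [Fintype E] (G : SignedGraph V E) : Prop :=
  ∃ k : ℕ, 0 < k ∧ ∃ (τ : E × Bool → ℤˣ) (f : E → ℤ), G.IsNZF τ f ∧ ∀ e, |f e| < k

/-- `G` admits a nowhere-zero `ℤ₂ × ℤ₃`-flow `(f₁, f₂)` such that `supp f₁` contains an even number
of negative edges. -/
def AdmitsBalancedNZF [Fintype E] (G : SignedGraph V E) : Prop :=
  ∃ (τ : E × Bool → ℤˣ) (f : E → ZMod 2 × ZMod 3),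
    G.IsNZF τ f ∧ Even {e : E | (f e).1 ≠ 0 ∧ G.sign e = -1}.ncard

/-! ### Subgraphs -/

/-- A (signed) subgraph: a set of vertices and a set of edges that contains, with each of its edges,
both ends of that edge. -/
structure Subgraph (G : SignedGraph V E) where
  verts : Finset V
  edges : Finset E
  vert_mem : ∀ h : E × Bool, h.1 ∈ edges → G.vert h ∈ verts

/-- A subgraph as a signed graph in its own right. -/
def Subgraph.toSigned {G : SignedGraph V E} (H : G.Subgraph) : SignedGraph H.verts H.edges where
  vert h := ⟨G.vert (h.1, h.2), H.vert_mem (h.1, h.2) h.1.2⟩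
  sign e := G.sign e

/-- A chord of `H` is an edge outside `H` both of whose ends are vertices of `H`. -/
def Subgraph.IsChord {G : SignedGraph V E} (H : G.Subgraph) (e : E) : Prop :=
  e ∉ H.edges ∧ ∀ b : Bool, G.vert (e, b) ∈ H.verts

open Classical in
/-- The subgraph `H + e` for a chord `e` of `H`. -/
noncomputable def Subgraph.addChord {G : SignedGraph V E} (H : G.Subgraph) (e : E)
    (he : H.IsChord e) : G.Subgraph where
  verts := H.verts
  edges := insert e H.edges
  vert_mem := by
    rintro ⟨e', b⟩ h
    rcases Finset.mem_insert.1 h with h | h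
    · have h' : e' = e := h
      rw [h']
      exact he.2 b
    · exact H.vert_mem _ h

/-- `𝒰(H)`: the chords `e` of `H` for which `H + e` is unbalanced. -/
def Subgraph.unbalancedChords {G : SignedGraph V E} (H : G.Subgraph) : Set E :=
  {e | ∃ he : H.IsChord e, ¬ (H.addChord e he).toSigned.IsBalanced}

/-- A circuit is a connected subgraph all of whose vertices have degree two (in the subgraph). -/
def Subgraph.IsCircuit {G : SignedGraph V E} (C : G.Subgraph) : Prop :=
  C.toSigned.IsConnected ∧ ∀ v, C.toSigned.degree v = 2

/-! ### Shrubberies -/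

structure IsShrubbery [Fintype E] (G : SignedGraph V E) : Prop where
  /-- (S1) The maximum degree is at most three. -/
  maxDegree : ∀ v, G.degree v ≤ 3
  /-- (S2) Every cubic subgraph is flow-admissible. -/
  cubic_flowAdmissible : ∀ H : G.Subgraph, H.toSigned.IsCubic → H.toSigned.IsFlowAdmissible
  /-- (S3) `|δ_G(V(H))| + ∑_{x ∈ V(H)} (3 - d_G(x)) + 2 |𝒰(H)| ≥ 4` for every balanced and connected
  subgraph `H` with at least two vertices. -/
  four_le : ∀ H : G.Subgraph, H.toSigned.IsBalanced → H.toSigned.IsConnected → 2 ≤ H.verts.card →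
    (4 : ℤ) ≤ (G.boundaryEdges (H.verts : Set V)).ncard + ∑ x ∈ H.verts, (3 - (G.degree x : ℤ)) +
      2 * H.unbalancedChords.ncard
  /-- (S4) There is no balanced circuit of length four. -/
  no_balanced_four_circuit : ∀ C : G.Subgraph, C.IsCircuit → C.edges.card = 4 →
    ¬ C.toSigned.IsBalanced

end SignedGraph

/-! A cubic shrubbery is a cubic subgraph of itself, so (S2) makes it flow-admissible, and (i)
implies (ii). The converse is an induction on `size`: a smallest flow-admissible graph without a
balanced flow would be a cubic shrubbery, apart from a detour for balanced graphs.

Most reductions contract positive edges. A flow of the contraction is lifted by choosing values on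
the contracted edges; being positive, these do not affect the parity condition. Switching, which
preserves integer flows and balanced flows, provides the positive edges. A vertex of degree `d`
weighs 1 if `d = 0`, 2 if `1 ≤ d ≤ 3` and `3 * d - 7` beyond, so that merging isolated vertices,
suppressing degree two, splitting degree at least four, and contracting cubic parts with at most
three outgoing half-edges all lower the size.

In the cubic case, a balanced 4-circuit is contracted and the flow lifted: the lifts differ by a
circulation, and four edges exclude at most four of its six possible values. For (S3), let at most
three half-edges leave `X` apart from its positive edges. Contracting `X` gives a flow outside,
contracting the complement (`cone`) gives one inside, and the two can be matched: by
`card_solutions_eq` the number of nowhere-zero extensions into `X` depends only on which partial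
sums of the boundary vanish, and three nonzero values with sum zero have no vanishing proper partial
sum. A balanced connected subgraph violating (S3) yields such an `X` once it is switched to be
positive, since its unbalanced chords then include all negative edges with both ends in `X`.

A connected balanced cubic graph is never a shrubbery, because (S3) fails for the whole graph. In an
all-positive cubic graph without small cuts, two disjoint edges are therefore recombined into two
negative ones (`flip`). The new graph is unbalanced and flow-admissible, so the previous argument
applies to it, and the parity condition is exactly what allows its flow to be carried back. -/

namespace SignedGraph

/-! ### Flows in a fixed reference orientation -/

section Flux

variable {V : Type*} {E : Type*} {A : Type*} [AddCommGroup A]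

/-- The value that `f`, read with the reference orientation in which every `(e, false)` points away
from its end, sends out of the end of the half-edge `h`. -/
def halfValue (G : SignedGraph V E) (f : E → A) (h : E × Bool) : A :=
  if h.2 then -((G.sign h.1 : ℤ) • f h.1) else f h.1

@[simp] theorem halfValue_false (G : SignedGraph V E) (f : E → A) (e : E) :
    G.halfValue f (e, false) = f e := by simp [halfValue]

@[simp] theorem halfValue_true (G : SignedGraph V E) (f : E → A) (e : E) :
    G.halfValue f (e, true) = -((G.sign e : ℤ) • f e) := by simp [halfValue]

theorem halfValue_opp (G : SignedGraph V E) (f : E → A) (h : E × Bool) :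
    G.halfValue f (opp h) = -((G.sign h.1 : ℤ) • G.halfValue f h) := by
  obtain ⟨e, b⟩ := h
  cases b
  · simp [opp]
  · rcases Int.units_eq_one_or (G.sign e) with hs | hs <;> simp [opp, hs]

theorem halfValue_ne_zero {G : SignedGraph V E} {f : E → A} {h : E × Bool} (hf : f h.1 ≠ 0) :
    G.halfValue f h ≠ 0 := by
  obtain ⟨e, b⟩ := h
  cases b
  · simpa using hf
  · rcases Int.units_eq_one_or (G.sign e) with hs | hs <;> simpa [hs] using hf

theorem halfValue_congr {G : SignedGraph V E} {f g : E → A} {h : E × Bool} (hfg : f h.1 = g h.1) :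
    G.halfValue f h = G.halfValue g h := by
  simp [halfValue, hfg]

variable [Fintype E]

open Classical in
/-- The total value that `f` sends out of the vertices of `X`. -/
noncomputable def flux (G : SignedGraph V E) (f : E → A) (X : Set V) : A :=
  ∑ h, if G.vert h ∈ X then G.halfValue f h else 0

open Classical in
theorem flux_eq_sum_edges (G : SignedGraph V E) (f : E → A) (X : Set V) :
    G.flux f X = ∑ e, ((if G.vert (e, false) ∈ X then f e else 0) +
      (if G.vert (e, true) ∈ X then -((G.sign e : ℤ) • f e) else 0)) := by
  simp [flux, Fintype.sum_prod_type, add_comm]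

theorem flux_add (G : SignedGraph V E) (f g : E → A) (X : Set V) :
    G.flux (f + g) X = G.flux f X + G.flux g X := by
  classical
  simp only [flux, ← Finset.sum_add_distrib]
  refine Finset.sum_congr rfl fun h _ => ?_
  split_ifs <;> simp [halfValue]
  split_ifs <;> abel

theorem flux_neg (G : SignedGraph V E) (f : E → A) (X : Set V) :
    G.flux (-f) X = -G.flux f X := by
  classical
  simp only [flux, ← Finset.sum_neg_distrib]
  refine Finset.sum_congr rfl fun h _ => ?_
  split_ifs <;> simp [halfValue]
  split_ifs <;> simp

theorem flux_zero (G : SignedGraph V E) (X : Set V) : G.flux (0 : E → A) X = 0 := by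
  simp [flux, halfValue]

theorem flux_sub (G : SignedGraph V E) (f g : E → A) (X : Set V) :
    G.flux (f - g) X = G.flux f X - G.flux g X := by
  rw [sub_eq_add_neg, flux_add, flux_neg, sub_eq_add_neg]

theorem flux_map {B : Type*} [AddCommGroup B] (G : SignedGraph V E) (φ : A →+ B) (f : E → A)
    (X : Set V) : G.flux (fun e => φ (f e)) X = φ (G.flux f X) := by
  classical
  simp only [flux, map_sum]
  refine Finset.sum_congr rfl fun h _ => ?_
  split_ifs <;> simp [halfValue]
  split_ifs <;> simp

open Classical in
theorem flux_eq_sum_singleton [Fintype V] (G : SignedGraph V E) (f : E → A) (X : Set V) :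
    G.flux f X = ∑ v with v ∈ X, G.flux f {v} := by
  simp only [flux]
  rw [Finset.sum_comm]
  refine Finset.sum_congr rfl fun h _ => ?_
  simp [Finset.sum_ite_eq]

/-- `f` is a flow for the reference orientation. -/
def IsFlow (G : SignedGraph V E) (f : E → A) : Prop := ∀ v, G.flux f {v} = 0

theorem IsFlow.flux_eq_zero [Fintype V] {G : SignedGraph V E} {f : E → A} (hf : G.IsFlow f)
    (X : Set V) : G.flux f X = 0 := by
  classical
  rw [flux_eq_sum_singleton]
  exact Finset.sum_eq_zero fun v _ => hf v

theorem flux_singleton_eq_sum (G : SignedGraph V E) (f : E → A) (v : V) :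
    G.flux f {v} = ∑ h ∈ G.halfEdgesAt v, G.halfValue f h := by
  classical
  simp [flux, halfEdgesAt, Finset.sum_filter]

theorem mem_halfEdgesAt {G : SignedGraph V E} {v : V} {h : E × Bool} :
    h ∈ G.halfEdgesAt v ↔ G.vert h = v := by
  simp [halfEdgesAt]

end Flux

/-! ### Orientation-free forms of the two flow properties -/

section Predicates

variable {V : Type*} {E : Type*}

theorem isOrientation_true {G : SignedGraph V E} {τ : E × Bool → ℤˣ} (hτ : G.IsOrientation τ)
    (e : E) : τ (e, true) = -(G.sign e * τ (e, false)) := by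
  have := hτ (e, false)
  simp only [opp, Bool.not_false] at this
  rcases Int.units_eq_one_or (τ (e, false)) with h | h <;> rw [h] at this ⊢ <;> simp at this ⊢
  · exact this
  · rw [← this]

/-- The orientation in which all half-edges `(e, false)` point away from their ends. -/
def refOrientation (G : SignedGraph V E) (h : E × Bool) : ℤˣ := if h.2 then -G.sign h.1 else 1

theorem isOrientation_refOrientation (G : SignedGraph V E) :
    G.IsOrientation G.refOrientation := by
  rintro ⟨e, b⟩
  cases b <;> simp [refOrientation, opp]

variable [Fintype E]

/-- There is a nowhere-zero integer flow. -/
def HasIntFlow (G : SignedGraph V E) : Prop := ∃ f : E → ℤ, G.IsFlow f ∧ ∀ e, f e ≠ 0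

open Classical in
/-- There is a nowhere-zero `ℤ₂ × ℤ₃`-flow with an even number of negative edges in the support of
its first component. -/
def HasBalancedFlow (G : SignedGraph V E) : Prop :=
  ∃ f : E → ZMod 2 × ZMod 3, G.IsFlow f ∧ (∀ e, f e ≠ 0) ∧ ∏ e with (f e).1 ≠ 0, G.sign e = 1

/-- Reversing both halves of an edge amounts to negating its value, so every orientation can be
traded for the reference one without changing supports. -/
theorem boundary_eq_flux {A : Type*} [AddCommGroup A] {G : SignedGraph V E} {τ : E × Bool → ℤˣ}
    (hτ : G.IsOrientation τ) (f : E → A) (v : V) :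
    G.boundary τ f v = G.flux (fun e => (τ (e, false) : ℤ) • f e) {v} := by
  rw [flux_singleton_eq_sum, boundary]
  refine Finset.sum_congr rfl fun h _ => ?_
  obtain ⟨e, b⟩ := h
  cases b
  · simp
  · simp [isOrientation_true hτ, mul_smul]

theorem units_smul_ne_zero {A : Type*} [AddCommGroup A] (s : ℤˣ) {a : A} (ha : a ≠ 0) :
    (s : ℤ) • a ≠ 0 := by
  rcases Int.units_eq_one_or s with h | h <;> simpa [h] using ha

theorem isFlowAdmissible_iff {G : SignedGraph V E} : G.IsFlowAdmissible ↔ G.HasIntFlow := by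
  constructor
  · rintro ⟨k, -, τ, f, ⟨hτ, hf, h0⟩, -⟩
    exact ⟨fun e => (τ (e, false) : ℤ) • f e, fun v => by rw [← boundary_eq_flux hτ, hf],
      fun e => units_smul_ne_zero _ (h0 e)⟩
  · rintro ⟨f, hf, h0⟩
    refine ⟨∑ e, (f e).natAbs + 1, Nat.succ_pos _, G.refOrientation, f,
      ⟨G.isOrientation_refOrientation, fun v => ?_, h0⟩, fun e => ?_⟩
    · rw [boundary_eq_flux G.isOrientation_refOrientation]
      simpa [refOrientation] using hf v
    · have := Finset.single_le_sum (f := fun e => (f e).natAbs) (fun _ _ => Nat.zero_le _)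
        (Finset.mem_univ e)
      push_cast
      have h2 : ((f e).natAbs : ℤ) ≤ ((∑ e, (f e).natAbs : ℕ) : ℤ) := by exact_mod_cast this
      rw [Int.natCast_natAbs] at h2
      push_cast at h2
      linarith

theorem prod_sign_eq_one_iff (s : E → ℤˣ) (p : E → Prop) [DecidablePred p] :
    ∏ e with p e, s e = 1 ↔ Even {e : E | p e ∧ s e = -1}.ncard := by
  classical
  have h1 : {e : E | p e ∧ s e = -1} = ((Finset.univ.filter p).filter fun e => s e = -1 : Finset E) := by
    ext; simp
  rw [h1, Set.ncard_coe_finset]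
  have h2 : ∏ e with p e, s e = ∏ e ∈ Finset.univ.filter p, if s e = -1 then (-1 : ℤˣ) else 1 := by
    refine Finset.prod_congr rfl fun e _ => ?_
    rcases Int.units_eq_one_or (s e) with h | h <;> simp [h]
  rw [h2, ← Finset.prod_filter, Finset.prod_const]
  exact neg_one_pow_eq_one_iff_even (by decide)

theorem admitsBalancedNZF_iff {G : SignedGraph V E} :
    G.AdmitsBalancedNZF ↔ G.HasBalancedFlow := by
  classical
  constructor
  · rintro ⟨τ, f, ⟨hτ, hf, h0⟩, hev⟩
    refine ⟨fun e => (τ (e, false) : ℤ) • f e, fun v => by rw [← boundary_eq_flux hτ, hf],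
      fun e => units_smul_ne_zero _ (h0 e), ?_⟩
    rw [prod_sign_eq_one_iff]
    convert hev using 6 with e
    rcases Int.units_eq_one_or (τ (e, false)) with h | h <;> simp [h]
  · rintro ⟨f, hf, h0, hev⟩
    refine ⟨G.refOrientation, f, ⟨G.isOrientation_refOrientation, fun v => ?_, h0⟩, ?_⟩
    · rw [boundary_eq_flux G.isOrientation_refOrientation]
      simpa [refOrientation] using hf v
    · rwa [prod_sign_eq_one_iff] at hev

end Predicates

/-! ### Invariance under switching -/

section Switching

variable {V : Type*} {E : Type*}

/-- The signed graph obtained by switching at all vertices `v` with `s v = -1`. -/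
def reswitch (G : SignedGraph V E) (s : V → ℤˣ) : SignedGraph V E where
  vert := G.vert
  sign e := s (G.vert (e, false)) * s (G.vert (e, true)) * G.sign e

theorem SwitchEquiv.exists_reswitch {G G' : SignedGraph V E} (h : G.SwitchEquiv G') :
    ∃ s : V → ℤˣ, G' = G.reswitch s := by
  classical
  induction h with
  | refl => exact ⟨1, by simp [reswitch]⟩
  | tail _ hst ih =>
    obtain ⟨s, rfl⟩ := ih
    obtain ⟨v, rfl⟩ := hst
    refine ⟨fun x => if x = v then -s x else s x, ?_⟩
    simp only [switch, reswitch, boundaryEdges, mk.injEq, true_and, Set.mem_ofPred_eq,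
      Set.mem_singleton_iff]
    funext e
    by_cases h1 : G.vert (e, false) = v <;> by_cases h2 : G.vert (e, true) = v <;> simp [h1, h2]

theorem IsBalanced.exists_sign_eq {G : SignedGraph V E} (h : G.IsBalanced) :
    ∃ s : V → ℤˣ, ∀ e, G.sign e = s (G.vert (e, false)) * s (G.vert (e, true)) := by
  obtain ⟨G', h, h1⟩ := h
  obtain ⟨s, rfl⟩ := h.exists_reswitch
  refine ⟨s, fun e => ?_⟩
  have := h1 e
  simp only [reswitch] at this
  rcases Int.units_eq_one_or (s (G.vert (e, false))) with h1 | h1 <;>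
  rcases Int.units_eq_one_or (s (G.vert (e, true))) with h2 | h2 <;>
  rw [h1, h2] at this ⊢ <;> simpa [neg_eq_iff_eq_neg] using this

theorem halfValue_reswitch {A : Type*} [AddCommGroup A] (G : SignedGraph V E) (s : V → ℤˣ)
    (f : E → A) (h : E × Bool) :
    (G.reswitch s).halfValue (fun e => (s (G.vert (e, false)) : ℤ) • f e) h =
      (s (G.vert h) : ℤ) • G.halfValue f h := by
  obtain ⟨e, b⟩ := h
  cases b
  · simp
  · rcases Int.units_eq_one_or (s (G.vert (e, false))) with h1 | h1 <;>
      simp [reswitch, h1, mul_smul]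

theorem reswitch_reswitch (G : SignedGraph V E) (s : V → ℤˣ) :
    (G.reswitch s).reswitch s = G := by
  cases G with
  | mk vert sign =>
    simp only [reswitch, mk.injEq, true_and]
    funext e
    rcases Int.units_eq_one_or (s (vert (e, false))) with h1 | h1 <;>
    rcases Int.units_eq_one_or (s (vert (e, true))) with h2 | h2 <;> simp [h1, h2]

variable [Fintype E]

theorem IsFlow.reswitch {A : Type*} [AddCommGroup A] {G : SignedGraph V E} {f : E → A}
    (hf : G.IsFlow f) (s : V → ℤˣ) :
    (G.reswitch s).IsFlow (fun e => (s (G.vert (e, false)) : ℤ) • f e) := by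
  intro v
  have h1 := hf v
  rw [flux_singleton_eq_sum] at h1 ⊢
  have : ∑ h ∈ (G.reswitch s).halfEdgesAt v,
      (G.reswitch s).halfValue (fun e => (s (G.vert (e, false)) : ℤ) • f e) h =
      ∑ h ∈ G.halfEdgesAt v, (s v : ℤ) • G.halfValue f h := by
    refine Finset.sum_congr rfl fun h hh => ?_
    rw [halfValue_reswitch, show G.vert h = v from mem_halfEdgesAt.1 hh]
  rw [this, ← Finset.smul_sum, h1, smul_zero]

theorem HasIntFlow.reswitch {G : SignedGraph V E} (h : G.HasIntFlow) (s : V → ℤˣ) :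
    (G.reswitch s).HasIntFlow := by
  obtain ⟨f, hf, h0⟩ := h
  exact ⟨_, hf.reswitch s, fun e => units_smul_ne_zero _ (h0 e)⟩

theorem even_card_support_halfEdgesAt {G : SignedGraph V E} {f : E → ZMod 2} (hf : G.IsFlow f)
    (v : V) [DecidablePred fun h : E × Bool => f h.1 ≠ 0] :
    Even ((G.halfEdgesAt v).filter fun h => f h.1 ≠ 0).card := by
  have h1 := hf v
  rw [flux_singleton_eq_sum] at h1
  have h2 : ∑ h ∈ G.halfEdgesAt v, G.halfValue f h =
      ∑ h ∈ G.halfEdgesAt v, if f h.1 ≠ 0 then (1 : ZMod 2) else 0 := by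
    refine Finset.sum_congr rfl fun h _ => ?_
    obtain ⟨e, b⟩ := h
    have key : ∀ x : ZMod 2, x ≠ 0 → x = 1 := by decide
    have key2 : ∀ x : ZMod 2, -x = x := by decide
    have h3 : G.halfValue f (e, b) = f e := by
      cases b
      · simp
      · rcases Int.units_eq_one_or (G.sign e) with hs | hs <;> simp [hs, key2]
    rw [h3]
    split_ifs with h4
    · exact key _ h4
    · simpa using h4
  rw [h2, ← Finset.sum_filter, Finset.sum_const, nsmul_one] at h1
  exact (ZMod.natCast_eq_zero_iff_even).1 h1

/-- Grouped by vertices, the change in the sign product is a product of powers `s v ^ k`, where `k`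
counts the half-edges at `v` in the support of the first component. A `ℤ₂`-flow makes every `k`
even. -/
theorem HasBalancedFlow.reswitch [Fintype V] {G : SignedGraph V E} (h : G.HasBalancedFlow)
    (s : V → ℤˣ) : (G.reswitch s).HasBalancedFlow := by
  classical
  obtain ⟨f, hf, h0, hp⟩ := h
  refine ⟨_, hf.reswitch s, fun e => units_smul_ne_zero _ (h0 e), ?_⟩
  have h1 : ∀ e, (((s (G.vert (e, false)) : ℤ) • f e).1 ≠ 0) ↔ (f e).1 ≠ 0 := fun e => by
    rcases Int.units_eq_one_or (s (G.vert (e, false))) with h | h <;> simp [h]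
  simp only [h1]
  simp only [SignedGraph.reswitch, Finset.prod_mul_distrib, hp, mul_one]
  rw [← Finset.prod_mul_distrib]
  have hf1 : G.IsFlow fun e => (f e).1 := fun v => by
    have := G.flux_map (AddMonoidHom.fst (ZMod 2) (ZMod 3)) f {v}
    rw [hf v] at this
    simpa using this
  calc ∏ e with (f e).1 ≠ 0, s (G.vert (e, false)) * s (G.vert (e, true))
      = ∏ h : E × Bool, if (f h.1).1 ≠ 0 then s (G.vert h) else 1 := by
        rw [Fintype.prod_prod_type, Finset.prod_filter]
        refine Finset.prod_congr rfl fun e _ => ?_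
        simp only [Fintype.prod_bool]
        split_ifs <;> simp [mul_comm]
    _ = ∏ v, ∏ h with G.vert h = v, if (f h.1).1 ≠ 0 then s (G.vert h) else 1 :=
        (Finset.prod_fiberwise _ _ _).symm
    _ = 1 := by
        refine Finset.prod_eq_one fun v _ => ?_
        rw [← Finset.prod_filter]
        have h2 : ∀ h ∈ (Finset.univ.filter fun h => G.vert h = v).filter
            (fun h => (f h.1).1 ≠ 0), s (G.vert h) = s v := fun h hh => by
          simp only [Finset.mem_filter] at hh
          rw [hh.1.2]
        rw [Finset.prod_congr rfl h2, Finset.prod_const]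
        obtain ⟨k, hk⟩ := even_card_support_halfEdgesAt hf1 v
        have h3 : ((Finset.univ.filter fun h => G.vert h = v).filter
            (fun h => (f h.1).1 ≠ 0)).card = k + k := by
          rw [← hk]; congr
        rw [h3, ← two_mul, pow_mul, Int.units_sq, one_pow]

theorem hasBalancedFlow_reswitch_iff [Fintype V] {G : SignedGraph V E} (s : V → ℤˣ) :
    (G.reswitch s).HasBalancedFlow ↔ G.HasBalancedFlow :=
  ⟨fun h => by simpa [reswitch_reswitch] using h.reswitch s, fun h => h.reswitch s⟩

end Switching

/-! ### Prescribed boundaries and the number of nowhere-zero solutions -/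

section Solvability

variable {V : Type*} {E : Type*} {A : Type*} [AddCommGroup A] [Fintype E]

/-- The boundary functions of maps that vanish on `Z`. -/
def boundaries (G : SignedGraph V E) (A : Type*) [AddCommGroup A] (Z : Set E) :
    AddSubgroup (V → A) where
  carrier := {b | ∃ f : E → A, (∀ e ∈ Z, f e = 0) ∧ ∀ v, G.flux f {v} = b v}
  add_mem' := by
    rintro b c ⟨f, hf, hf'⟩ ⟨g, hg, hg'⟩
    exact ⟨f + g, fun e he => by simp [hf e he, hg e he], fun v => by simp [flux_add, hf', hg']⟩
  zero_mem' := ⟨0, by simp, by simp [flux_zero]⟩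
  neg_mem' := by
    rintro b ⟨f, hf, hf'⟩
    exact ⟨-f, fun e he => by simp [hf e he], fun v => by simp [flux_neg, hf']⟩

/-- Two vertices are the ends of an edge outside `Z`. -/
def JoinedOff (G : SignedGraph V E) (Z : Set E) (x y : V) : Prop :=
  ∃ e ∉ Z, G.vert (e, false) = x ∧ G.vert (e, true) = y

theorem single_sub_single_mem [DecidableEq V] {G : SignedGraph V E} {Z : Set E}
    (hpos : ∀ e ∉ Z, G.sign e = 1) {x y : V} (h : Relation.EqvGen (G.JoinedOff Z) x y) (a : A) :
    Pi.single x a - Pi.single y a ∈ G.boundaries A Z := by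
  classical
  induction h with
  | rel x y h =>
    obtain ⟨e, he, rfl, rfl⟩ := h
    refine ⟨Pi.single e a, fun e' he' => ?_, fun v => ?_⟩
    · have : e' ≠ e := by rintro rfl; exact he he'
      simp [this]
    · rw [flux_eq_sum_edges, Finset.sum_eq_single e]
      · simp only [Pi.single_eq_same, hpos e he, Units.val_one, one_smul, Set.mem_singleton_iff,
          Pi.sub_apply, Pi.single_apply, eq_comm (a := v)]
        split_ifs <;> simp
      · intro e' _ he'
        simp [Pi.single_eq_of_ne he']
      · simp
  | refl x => simp [zero_mem]
  | symm x y _ ih => rw [← neg_sub]; exact neg_mem ih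
  | trans x y z _ _ ih1 ih2 => rw [← sub_add_sub_cancel]; exact add_mem ih1 ih2

-- With positive edges only, the total over a union of components is the sole obstruction: all
-- values can be pushed along paths to one representative per component, where they cancel.
open Classical in
theorem mem_boundaries_iff [Fintype V] {G : SignedGraph V E} {Z : Set E}
    (hpos : ∀ e ∉ Z, G.sign e = 1) (b : V → A) :
    b ∈ G.boundaries A Z ↔ ∀ Y : Set V,
      (∀ e ∉ Z, (G.vert (e, false) ∈ Y ↔ G.vert (e, true) ∈ Y)) → ∑ v with v ∈ Y, b v = 0 := by
  constructor
  · rintro ⟨f, hf, hb⟩ Y hY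
    simp only [← hb]
    rw [← flux_eq_sum_singleton, flux_eq_sum_edges]
    refine Finset.sum_eq_zero fun e _ => ?_
    by_cases he : e ∈ Z
    · simp [hf e he]
    · simp only [hY e he, hpos e he]
      split_ifs <;> simp
  · intro h
    let S : Setoid V := ⟨_, Relation.EqvGen.is_equivalence (G.JoinedOff Z)⟩
    let rep : V → V := fun x => (Quotient.mk S x).out
    have hrep : ∀ x, Relation.EqvGen (G.JoinedOff Z) x (rep x) := fun x =>
      (Quotient.mk_out (s := S) x).symm
    have h1 : b = ∑ x, (Pi.single x (b x) - Pi.single (rep x) (b x)) := by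
      rw [Finset.sum_sub_distrib, Finset.univ_sum_single, eq_comm, sub_eq_self]
      funext v
      rw [Finset.sum_apply, Pi.zero_apply]
      have := h {x | rep x = v} fun e he => by
        have : rep (G.vert (e, false)) = rep (G.vert (e, true)) := by
          simp only [rep]
          congr 1
          exact Quotient.sound (s := S) (Relation.EqvGen.rel _ _ ⟨e, he, rfl, rfl⟩)
        simp [this]
      rw [← this, Finset.sum_filter]
      refine Finset.sum_congr rfl fun x _ => ?_
      simp [Pi.single_apply, eq_comm]
    rw [h1]
    exact sum_mem fun x _ => single_sub_single_mem hpos (hrep x) _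

end Solvability

section Counting

variable {V : Type*} {E : Type*} {A : Type*} [AddCommGroup A] [Fintype A] [Fintype E] [Fintype V]

open Classical in
/-- The maps with boundary `b` that vanish on `Z` and do not vanish anywhere on `T`. -/
noncomputable def solutions (G : SignedGraph V E) (Z T : Finset E) (b : V → A) :
    Finset (E → A) :=
  {f | (∀ v, G.flux f {v} = b v) ∧ (∀ e ∈ Z, f e = 0) ∧ ∀ e ∈ T, f e ≠ 0}

-- Deletion recursion on `T`. With no nowhere-zero requirement, the solution sets are empty or
-- translates of the same group, and solvability is decided by the vanishing of partial sums.
open Classical in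
theorem card_solutions_eq (G : SignedGraph V E) (T : Finset E) {b b' : V → A}
    (hb : ∀ Y : Set V, ∑ v with v ∈ Y, b v = 0 ↔ ∑ v with v ∈ Y, b' v = 0) :
    ∀ Z : Finset E, (∀ e ∉ Z, G.sign e = 1) →
      (G.solutions Z T b).card = (G.solutions Z T b').card := by
  induction T using Finset.induction_on with
  | empty =>
    intro Z hZ
    have hZ' : ∀ e ∉ (Z : Set E), G.sign e = 1 := by simpa using hZ
    have hiff : b ∈ G.boundaries A (Z : Set E) ↔ b' ∈ G.boundaries A (Z : Set E) := by
      rw [mem_boundaries_iff hZ', mem_boundaries_iff hZ']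
      simp only [hb]
    by_cases h : b ∈ G.boundaries A (Z : Set E)
    · obtain ⟨f, hf, hfb⟩ := h
      obtain ⟨f', hf', hfb'⟩ := hiff.1 ⟨f, hf, hfb⟩
      refine Finset.card_bij' (fun g _ => g - f + f') (fun g _ => g - f' + f) ?_ ?_ ?_ ?_
      · intro g hg
        simp only [solutions, Finset.mem_filter, Finset.mem_univ, true_and] at hg ⊢
        refine ⟨fun v => by simp [flux_add, flux_sub, hg.1, hfb, hfb'], fun e he => ?_, by simp⟩
        simp [hg.2.1 e he, hf e he, hf' e he]
      · intro g hg
        simp only [solutions, Finset.mem_filter, Finset.mem_univ, true_and] at hg ⊢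
        refine ⟨fun v => by simp [flux_add, flux_sub, hg.1, hfb, hfb'], fun e he => ?_, by simp⟩
        simp [hg.2.1 e he, hf e he, hf' e he]
      · intro g _; simp
      · intro g _; simp
    · have h1 : G.solutions Z ∅ b = ∅ := by
        refine Finset.eq_empty_of_forall_notMem fun g hg => h ?_
        simp only [solutions, Finset.mem_filter, Finset.mem_univ, true_and] at hg
        exact ⟨g, hg.2.1, hg.1⟩
      have h2 : G.solutions Z ∅ b' = ∅ := by
        refine Finset.eq_empty_of_forall_notMem fun g hg => h (hiff.2 ?_)
        simp only [solutions, Finset.mem_filter, Finset.mem_univ, true_and] at hg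
        exact ⟨g, hg.2.1, hg.1⟩
      rw [h1, h2]
  | insert e T _ ih =>
    intro Z hZ
    -- A solution for `T` either vanishes at `e`, which moves `e` into `Z`, or is a solution for
    -- `insert e T`.
    have key : ∀ c : V → A, (G.solutions (insert e Z) T c).card +
        (G.solutions Z (insert e T) c).card = (G.solutions Z T c).card := by
      intro c
      rw [← Finset.card_filter_add_card_filter_not (s := G.solutions Z T c) (fun f => f e = 0)]
      congr 2 <;> ext f <;> simp only [solutions, Finset.mem_filter, Finset.mem_univ, true_and,
        Finset.forall_mem_insert] <;> tauto
    have h1 := key b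
    have h2 := key b'
    have h3 := ih Z hZ
    have h4 := ih (insert e Z) fun e' he' => hZ e' fun h => he' (Finset.mem_insert_of_mem h)
    omega

end Counting

section FluxSets

variable {V : Type*} {E : Type*} {A : Type*} [AddCommGroup A] [Fintype E]

theorem flux_insert (G : SignedGraph V E) (f : E → A) {v : V} {X : Set V} (hv : v ∉ X) :
    G.flux f (insert v X) = G.flux f {v} + G.flux f X := by
  classical
  simp only [flux, ← Finset.sum_add_distrib]
  refine Finset.sum_congr rfl fun h _ => ?_
  by_cases h1 : G.vert h = v
  · simp [h1, hv]
  · simp [h1]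

theorem flux_eq_zero_of_inside {G : SignedGraph V E} {f : E → A} {X : Set V}
    (h : ∀ e, f e ≠ 0 → G.sign e = 1 ∧ (G.vert (e, false) ∈ X ↔ G.vert (e, true) ∈ X)) :
    G.flux f X = 0 := by
  classical
  rw [flux_eq_sum_edges]
  refine Finset.sum_eq_zero fun e _ => ?_
  by_cases he : f e = 0
  · simp [he]
  · obtain ⟨h1, h2⟩ := h e he
    simp only [h1, h2]
    split_ifs <;> simp

theorem flux_eq_zero_of_outside {G : SignedGraph V E} {f : E → A} {X : Set V}
    (h : ∀ h : E × Bool, f h.1 ≠ 0 → G.vert h ∉ X) : G.flux f X = 0 := by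
  classical
  refine Finset.sum_eq_zero fun h' _ => ?_
  by_cases he : f h'.1 = 0
  · simp [halfValue, he]
  · simp [h h' he]

end FluxSets

/-! ### Contractions -/

section Contraction

variable {V V' : Type*} {E E' : Type*}

/-- `G'` arises from `G` by applying `p` to the vertices and deleting the edges outside the range of
`i`, which are positive and become loops. -/
structure IsContraction (G : SignedGraph V E) (G' : SignedGraph V' E') (p : V → V') (i : E' → E) :
    Prop where
  inj : Function.Injective i
  vert : ∀ e b, G'.vert (e, b) = p (G.vert (i e, b))
  sign : ∀ e, G'.sign e = G.sign (i e)
  collapsed : ∀ e ∉ Set.range i, G.sign e = 1 ∧ p (G.vert (e, false)) = p (G.vert (e, true))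

variable {G : SignedGraph V E} {G' : SignedGraph V' E'} {p : V → V'} {i : E' → E}
  [Fintype E] [Fintype E']

theorem IsContraction.flux_eq {A : Type*} [AddCommGroup A] (h : IsContraction G G' p i) (f : E → A)
    (X : Set V') : G'.flux (f ∘ i) X = G.flux f (p ⁻¹' X) := by
  classical
  rw [flux_eq_sum_edges, flux_eq_sum_edges]
  refine Finset.sum_of_injOn i h.inj.injOn (by simp) (fun e _ he => ?_) fun e _ => ?_
  · obtain ⟨h1, h2⟩ := h.collapsed e (by simpa using he)
    simp only [Set.mem_preimage, h1, h2]
    split_ifs <;> simp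
  · simp [h.vert, h.sign]

theorem IsContraction.isFlow {A : Type*} [AddCommGroup A] [Fintype V]
    (h : IsContraction G G' p i) {f : E → A} (hf : G.IsFlow f) : G'.IsFlow (f ∘ i) := fun v => by
  rw [h.flux_eq, hf.flux_eq_zero]

theorem IsContraction.hasIntFlow [Fintype V] (h : IsContraction G G' p i) (hG : G.HasIntFlow) :
    G'.HasIntFlow := by
  obtain ⟨f, hf, h0⟩ := hG
  exact ⟨f ∘ i, h.isFlow hf, fun e => h0 _⟩

theorem IsContraction.prod_sign (h : IsContraction G G' p i) (q : E → Prop) [DecidablePred q]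
    [DecidablePred fun e => q (i e)] : ∏ e with q (i e), G'.sign e = ∏ e with q e, G.sign e := by
  classical
  rw [Finset.prod_filter, Finset.prod_filter]
  refine Finset.prod_of_injOn i h.inj.injOn (by simp) (fun e _ he => ?_) fun e _ => ?_
  · simp [(h.collapsed e (by simpa using he)).1]
  · simp [h.sign]

theorem IsContraction.hasBalancedFlow [Fintype V] (h : IsContraction G G' p i)
    (hG : G.HasBalancedFlow) : G'.HasBalancedFlow := by
  classical
  obtain ⟨f, hf, h0, hp⟩ := hG
  refine ⟨f ∘ i, h.isFlow hf, fun e => h0 _, ?_⟩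
  rw [← hp, ← h.prod_sign fun e => (f e).1 ≠ 0]
  rfl

open Classical in
theorem IsContraction.degree_eq (h : IsContraction G G' p i) (v : V') :
    G'.degree v =
      (Finset.univ.filter fun x : E × Bool => p (G.vert x) = v ∧ x.1 ∈ Set.range i).card := by
  refine Finset.card_bij (fun x _ => (i x.1, x.2)) ?_ ?_ ?_
  · rintro ⟨e, b⟩ hx
    rw [mem_halfEdgesAt, h.vert] at hx
    simp [hx]
  · rintro ⟨e, b⟩ _ ⟨e', b'⟩ _ hx
    simp only [Prod.mk.injEq] at hx ⊢
    exact ⟨h.inj hx.1, hx.2⟩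
  · rintro ⟨e, b⟩ hx
    simp only [Finset.mem_filter, Finset.mem_univ, true_and] at hx
    obtain ⟨hx, e', rfl⟩ := hx
    exact ⟨(e', b), by rw [mem_halfEdgesAt, h.vert, hx], rfl⟩

end Contraction

/-! ### The induction parameter -/

/-- The contribution of a vertex of degree `d` to the size of a signed graph. -/
def weight (d : ℕ) : ℕ := if d = 0 then 1 else max 2 (3 * d - 7)

/-- The parameter for the induction. -/
noncomputable def size {V E : Type*} [Fintype V] [Fintype E] (G : SignedGraph V E) : ℕ :=
  ∑ v, weight (G.degree v)

/-- The flow-admissible signed graphs of size less than `n` have balanced flows. -/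
def BalancedFlowBelow (n : ℕ) : Prop :=
  ∀ (V : Type u) (E : Type v) [Fintype V] [Fintype E] (G : SignedGraph V E),
    G.size < n → G.HasIntFlow → G.HasBalancedFlow

theorem size_reswitch {V E : Type*} [Fintype V] [Fintype E] (G : SignedGraph V E) (s : V → ℤˣ) :
    (G.reswitch s).size = G.size := rfl

section Contract

variable {V : Type*} {E : Type*}

open Classical in
/-- The map that identifies all members of `X`. -/
noncomputable def collapse (X : Finset V) (v : V) : Option {v // v ∉ X} :=
  if h : v ∈ X then none else some ⟨v, h⟩

theorem collapse_eq_none {X : Finset V} {v : V} : collapse X v = none ↔ v ∈ X := by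
  simp [collapse]

theorem collapse_eq_some {X : Finset V} {v : V} {w : {v // v ∉ X}} :
    collapse X v = some w ↔ v = w := by
  unfold collapse
  split_ifs with h
  · simp only [false_iff]
    rintro rfl
    exact w.2 h
  · simp [Subtype.ext_iff]

/-- Identify the members of `X` and delete the edges in `D`. -/
noncomputable def contract (G : SignedGraph V E) (X : Finset V) (D : Finset E) :
    SignedGraph (Option {v // v ∉ X}) {e // e ∉ D} where
  vert h := collapse X (G.vert (h.1, h.2))
  sign e := G.sign e

/-- The edges of `D` are positive and have both ends in `X`. -/
def PositiveInside (G : SignedGraph V E) (X : Finset V) (D : Finset E) : Prop :=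
  ∀ e ∈ D, G.sign e = 1 ∧ ∀ b, G.vert (e, b) ∈ X

theorem PositiveInside.isContraction {G : SignedGraph V E} {X : Finset V} {D : Finset E}
    (h : G.PositiveInside X D) : IsContraction G (G.contract X D) (collapse X) Subtype.val where
  inj := Subtype.val_injective
  vert _ _ := rfl
  sign _ := rfl
  collapsed e he := by
    obtain ⟨h1, h2⟩ := h e (by simpa using he)
    rw [collapse_eq_none.2 (h2 _), collapse_eq_none.2 (h2 _)]
    exact ⟨h1, rfl⟩

variable [Fintype E]

open Classical in
/-- The half-edges incident with members of `X` whose edges are not in `D`. -/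
noncomputable def outHalfEdges (G : SignedGraph V E) (X : Finset V) (D : Finset E) :
    Finset (E × Bool) :=
  {h | G.vert h ∈ X ∧ h.1 ∉ D}

theorem mem_outHalfEdges {G : SignedGraph V E} {X : Finset V} {D : Finset E} {h : E × Bool} :
    h ∈ G.outHalfEdges X D ↔ G.vert h ∈ X ∧ h.1 ∉ D := by
  simp [outHalfEdges]

theorem PositiveInside.size_contract [Fintype V] {G : SignedGraph V E} {X : Finset V} {D : Finset E}
    (h : G.PositiveInside X D) [Fintype {v // v ∉ X}] [Fintype {e // e ∉ D}] :
    (G.contract X D).size + ∑ v ∈ X, weight (G.degree v) =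
      G.size + weight (G.outHalfEdges X D).card := by
  classical
  have h1 : (G.contract X D).degree none = (G.outHalfEdges X D).card := by
    rw [h.isContraction.degree_eq]
    congr 1
    ext x
    simp [mem_outHalfEdges, collapse_eq_none]
  have h2 : ∀ w : {v // v ∉ X}, (G.contract X D).degree (some w) = G.degree w := by
    intro w
    rw [h.isContraction.degree_eq, degree]
    congr 1
    ext x
    simp only [collapse_eq_some, Finset.mem_filter, Finset.mem_univ, true_and, mem_halfEdgesAt,
      Subtype.range_coe_subtype, Set.mem_ofPred_eq, and_iff_left_iff_imp]
    intro hx hD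
    exact w.2 (hx ▸ (h _ hD).2 x.2)
  rw [size, Fintype.sum_option, h1, size, ← Finset.sum_add_sum_compl X]
  simp only [h2]
  rw [Finset.sum_subtype (p := fun v => v ∉ X) Xᶜ (by simp)]
  ring

/-- Edges of `D` are positive, so any values on them leave the sign product alone. What remains is
the local problem `hext`: extend a map with total flux zero out of `X` to the edges of `D`. -/
theorem PositiveInside.hasBalancedFlow {G : SignedGraph V E} {X : Finset V} {D : Finset E}
    (h : G.PositiveInside X D) [Fintype {e // e ∉ D}]
    (hbal : (G.contract X D).HasBalancedFlow)
    (hext : ∀ f : E → ZMod 2 × ZMod 3, (∀ e ∈ D, f e = 0) → (∀ e ∉ D, f e ≠ 0) →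
      G.flux f (X : Set V) = 0 → ∃ g : E → ZMod 2 × ZMod 3, (∀ e ∉ D, g e = 0) ∧
        (∀ e ∈ D, g e ≠ 0) ∧ ∀ v ∈ X, G.flux (f + g) {v} = 0) : G.HasBalancedFlow := by
  classical
  obtain ⟨f', hf', h0, hp⟩ := hbal
  set f : E → ZMod 2 × ZMod 3 := fun e => if he : e ∈ D then 0 else f' ⟨e, he⟩ with hf
  have hfi : f ∘ Subtype.val = f' := by
    funext e
    simp [hf, e.2]
  have hflux : ∀ y, G.flux f (collapse X ⁻¹' {y}) = 0 := fun y => by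
    rw [← h.isContraction.flux_eq, hfi, hf']
  obtain ⟨g, hg, hg0, hfg⟩ := hext f (fun e he => by simp [hf, he])
    (fun e he => by simpa [hf, he] using h0 _) (by
      convert hflux none using 2
      ext v
      simp [collapse_eq_none])
  refine ⟨f + g, fun v => ?_, fun e => ?_, ?_⟩
  · by_cases hv : v ∈ X
    · exact hfg v hv
    · rw [flux_add, flux_eq_zero_of_outside (f := g), add_zero]
      · convert hflux (some ⟨v, hv⟩) using 2
        ext w
        simp [collapse_eq_some]
      · intro x hx hxv
        have hxD : x.1 ∈ D := by
          by_contra hxD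
          exact hx (hg _ hxD)
        exact hv (hxv ▸ (h _ hxD).2 x.2)
  · by_cases he : e ∈ D
    · simpa [hf, he] using hg0 e he
    · simpa [hg e he, hf, he] using h0 _
  · rw [← h.isContraction.prod_sign fun e => ((f + g) e).1 ≠ 0, ← hp]
    refine Finset.prod_congr (Finset.filter_congr fun e _ => ?_) fun _ _ => rfl
    simp [hf, hg _ e.2, e.2]

end Contract

theorem BalancedFlowBelow.of_contract {n : ℕ} (hn : BalancedFlowBelow.{u, v} n) {V : Type u}
    {E : Type v} [Fintype V] [Fintype E] {G : SignedGraph V E} (hG : G.HasIntFlow)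
    (hsize : G.size ≤ n) {X : Finset V} {D : Finset E} (h : G.PositiveInside X D)
    (hw : weight (G.outHalfEdges X D).card < ∑ v ∈ X, weight (G.degree v))
    (hext : ∀ f : E → ZMod 2 × ZMod 3, (∀ e ∈ D, f e = 0) → (∀ e ∉ D, f e ≠ 0) →
      G.flux f (X : Set V) = 0 → ∃ g : E → ZMod 2 × ZMod 3, (∀ e ∉ D, g e = 0) ∧
        (∀ e ∈ D, g e ≠ 0) ∧ ∀ v ∈ X, G.flux (f + g) {v} = 0) : G.HasBalancedFlow := by
  classical
  refine h.hasBalancedFlow (hn _ _ _ ?_ (h.isContraction.hasIntFlow hG)) hext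
  have := h.size_contract
  omega

theorem HasBalancedFlow.of_isEmpty {V E : Type*} [Fintype E] [IsEmpty E] (G : SignedGraph V E) :
    G.HasBalancedFlow :=
  ⟨0, fun v => flux_zero G {v}, fun e => isEmptyElim e, by simp⟩

theorem HasIntFlow.degree_ne_one {V E : Type*} [Fintype E] {G : SignedGraph V E}
    (hG : G.HasIntFlow) (v : V) : G.degree v ≠ 1 := fun hv => by
  obtain ⟨h, hh⟩ := Finset.card_eq_one.1 hv
  obtain ⟨f, hf, h0⟩ := hG
  have := hf v
  rw [flux_singleton_eq_sum, hh, Finset.sum_singleton] at this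
  exact halfValue_ne_zero (h0 _) this

/-! ### Vertices of degree zero and two -/

section LowDegree

variable {n : ℕ} {V : Type u} {E : Type v} [Fintype V] [Fintype E] {G : SignedGraph V E}

theorem BalancedFlowBelow.of_degree_zero (hn : BalancedFlowBelow.{u, v} n) (hG : G.HasIntFlow)
    (hsize : G.size ≤ n) {v : V} (hv : G.degree v = 0) : G.HasBalancedFlow := by
  classical
  have hv' : ∀ h, G.vert h ≠ v := fun h hh => by
    have h1 := Finset.card_eq_zero.1 hv
    have h2 : h ∈ G.halfEdgesAt v := mem_halfEdgesAt.2 hh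
    simp [h1] at h2
  rcases isEmpty_or_nonempty E with hE | ⟨⟨e⟩⟩
  · exact .of_isEmpty G
  · set w := G.vert (e, false) with hw
    have hvw : v ≠ w := (hv' _).symm
    have hout : (G.outHalfEdges {v, w} ∅).card = G.degree w := by
      congr 1
      ext h
      simp [mem_outHalfEdges, mem_halfEdgesAt, hv']
    -- The isolated vertex is merged with a vertex incident with an edge. Its weight 1 is what the
    -- size loses.
    refine hn.of_contract hG hsize (X := {v, w}) (D := ∅) (by simp [PositiveInside]) ?_
      fun f _ _ hf => ⟨0, by simp, by simp, ?_⟩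
    · rw [hout, Finset.sum_pair hvw, hv]
      simp [weight]
    · have h1 : G.flux f {v} = 0 := by
        rw [flux_eq_zero_of_outside]
        simpa using fun e b _ => hv' (e, b)
      rw [Finset.coe_pair, flux_insert _ _ (by simpa using hvw), h1, zero_add] at hf
      simp [h1, hf]

open Classical in
theorem BalancedFlowBelow.of_loop (hn : BalancedFlowBelow.{u, v} n) (hG : G.HasIntFlow)
    (hsize : G.size ≤ n) {v : V} {e : E} (he : G.halfEdgesAt v = {(e, false), (e, true)}) :
    G.HasBalancedFlow := by
  classical
  -- A negative loop alone at its vertex would contribute `2 * f e`, which is nonzero.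
  have hsign : G.sign e = 1 := by
    obtain ⟨f, hf, h0⟩ := hG
    have := hf v
    rw [flux_singleton_eq_sum, he, Finset.sum_pair (by simp)] at this
    rcases Int.units_eq_one_or (G.sign e) with hs | hs
    · exact hs
    · simp only [halfValue_false, halfValue_true, hs] at this
      simp at this
      exact absurd this (h0 e)
  have hmem : ∀ b, G.vert (e, b) = v := fun b => by
    rw [← mem_halfEdgesAt, he]
    cases b <;> simp
  have hpos : G.PositiveInside {v} {e} := by
    simp [PositiveInside, hsign, hmem]
  refine hn.of_contract hG hsize hpos ?_ fun f hf _ _ => ⟨Pi.single e (0, 1), ?_, ?_, ?_⟩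
  · have h1 : G.outHalfEdges {v} {e} = ∅ := by
      refine Finset.eq_empty_of_forall_notMem fun h hh => ?_
      rw [mem_outHalfEdges, Finset.mem_singleton, ← mem_halfEdgesAt, he] at hh
      simp only [Finset.mem_insert, Finset.mem_singleton] at hh
      rcases hh with ⟨rfl | rfl, hh⟩ <;> simp at hh
    have h2 : G.degree v = 2 := by rw [degree, he, Finset.card_pair (by simp)]
    simp [h1, h2, weight]
  · intro e' he'
    rw [Finset.mem_singleton] at he'
    exact Pi.single_eq_of_ne he' _
  · simp
  · intro w hw
    rw [Finset.mem_singleton.1 hw, flux_singleton_eq_sum, he, Finset.sum_pair (by simp)]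
    simp only [halfValue_false, halfValue_true, hsign, Units.val_one, one_smul, add_neg_cancel]

open Classical in
theorem BalancedFlowBelow.of_positive_series (hn : BalancedFlowBelow.{u, v} n)
    (hG : G.HasIntFlow) (hsize : G.size ≤ n) {v : V} {h₁ h₂ : E × Bool} (hne : h₁.1 ≠ h₂.1)
    (he : G.halfEdgesAt v = {h₁, h₂}) (hsign : G.sign h₁.1 = 1) : G.HasBalancedFlow := by
  classical
  have hne' : h₁ ≠ h₂ := fun h => hne (by rw [h])
  have hv1 : G.vert h₁ = v := by rw [← mem_halfEdgesAt, he]; simp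
  have hv2 : G.vert h₂ = v := by rw [← mem_halfEdgesAt, he]; simp
  set w := G.vert (opp h₁) with hw
  have hopp : opp h₁ ≠ h₁ := fun h => by
    have := congrArg Prod.snd h
    simp [opp] at this
  have hvw : v ≠ w := by
    intro hvw
    have h1 : opp h₁ ∈ G.halfEdgesAt v := mem_halfEdgesAt.2 (by rw [← hw, ← hvw])
    rw [he, Finset.mem_insert, Finset.mem_singleton] at h1
    rcases h1 with h1 | h1
    · exact hopp h1
    · exact hne (by rw [← h1]; rfl)
  have hmem : ∀ b, G.vert (h₁.1, b) = v ∨ G.vert (h₁.1, b) = w := by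
    intro b
    by_cases hb : b = h₁.2
    · left; rw [← hv1, hb]
    · right
      rw [hw, opp]
      congr 2
      revert hb; cases b <;> cases h₁.2 <;> simp
  have hpos : G.PositiveInside {v, w} {h₁.1} := by
    simp only [PositiveInside, Finset.mem_singleton, forall_eq, hsign, true_and, Finset.mem_insert]
    exact hmem
  have hout : (G.outHalfEdges {v, w} {h₁.1}).card = G.degree w := by
    have h1 : G.outHalfEdges {v, w} {h₁.1} =
        insert h₂ ((G.halfEdgesAt w).erase (opp h₁)) := by
      ext h
      simp only [mem_outHalfEdges, Finset.mem_insert, Finset.mem_singleton, Finset.mem_erase,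
        mem_halfEdgesAt]
      constructor
      · rintro ⟨h1 | h1, h2⟩
        · rw [← mem_halfEdgesAt, he, Finset.mem_insert, Finset.mem_singleton] at h1
          rcases h1 with rfl | rfl
          · exact absurd rfl h2
          · exact Or.inl rfl
        · right
          refine ⟨?_, h1⟩
          rintro rfl
          exact h2 rfl
      · rintro (rfl | ⟨h1, h2⟩)
        · exact ⟨Or.inl hv2, hne.symm⟩
        · refine ⟨Or.inr h2, fun h3 => ?_⟩
          have h4 : h = h₁ ∨ h = opp h₁ := by
            obtain ⟨e, b⟩ := h
            obtain ⟨e', b'⟩ := h₁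
            simp only at h3
            subst h3
            cases b <;> cases b' <;> simp [opp]
          rcases h4 with rfl | h4
          · exact hvw (by rw [← hv1, h2])
          · exact h1 h4
    have h2 : opp h₁ ∈ G.halfEdgesAt w := mem_halfEdgesAt.2 rfl
    rw [h1, Finset.card_insert_of_notMem, Finset.card_erase_add_one h2, degree]
    simp only [Finset.mem_erase, mem_halfEdgesAt, not_and]
    intro _ h3
    exact hvw (by rw [← hv2, h3])
  refine hn.of_contract hG hsize hpos ?_ fun f hf hf0 hfX => ?_
  · rw [hout, Finset.sum_pair hvw, degree, degree, he, Finset.card_pair hne']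
    simp [weight]
  · set a : ZMod 2 × ZMod 3 := if h₁.2 then G.halfValue f h₂ else -G.halfValue f h₂ with ha
    have ha0 : a ≠ 0 := by
      have h1 : G.halfValue f h₂ ≠ 0 :=
        halfValue_ne_zero (hf0 _ (by simpa using hne.symm))
      rw [ha]
      split_ifs
      · exact h1
      · exact neg_ne_zero.2 h1
    have hg : ∀ e', (Pi.single h₁.1 a : E → ZMod 2 × ZMod 3) e' ≠ 0 → e' = h₁.1 := fun e' h => by
      by_contra h'
      exact h (by simp [h'])
    have hv : G.flux (f + Pi.single h₁.1 a) {v} = 0 := by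
      rw [flux_singleton_eq_sum, he, Finset.sum_pair hne']
      have h1 : G.halfValue (f + Pi.single h₁.1 a) h₂ = G.halfValue f h₂ := by
        refine halfValue_congr ?_
        simp [Pi.single_eq_of_ne hne.symm]
      have h2 : G.halfValue (f + Pi.single h₁.1 a) h₁ = -G.halfValue f h₂ := by
        have h3 : (f + Pi.single h₁.1 a : E → ZMod 2 × ZMod 3) h₁.1 = a := by
          simp [hf h₁.1 (by simp)]
        rw [halfValue, h3, ha, hsign]
        split_ifs <;> simp
      rw [h1, h2, neg_add_cancel]
    refine ⟨Pi.single h₁.1 a, fun e' he' => ?_, by simpa using ha0, ?_⟩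
    · by_contra h
      exact he' (by rw [hg e' h]; simp)
    · have hX : G.flux (f + Pi.single h₁.1 a) (({v, w} : Finset V) : Set V) = 0 := by
        rw [flux_add, hfX, zero_add]
        refine flux_eq_zero_of_inside fun e' he' => ?_
        rw [hg e' he']
        exact ⟨hsign, iff_of_true ((hpos _ (by simp)).2 _) ((hpos _ (by simp)).2 _)⟩
      rw [Finset.coe_pair, flux_insert _ _ (by simpa using hvw), hv, zero_add] at hX
      simp [hv, hX]

theorem BalancedFlowBelow.of_degree_two (hn : BalancedFlowBelow.{u, v} n) (hG : G.HasIntFlow)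
    (hsize : G.size ≤ n) {v : V} (hv : G.degree v = 2) : G.HasBalancedFlow := by
  classical
  obtain ⟨h₁, h₂, hne, he⟩ := Finset.card_eq_two.1 hv
  by_cases hE : h₁.1 = h₂.1
  · obtain ⟨e, b⟩ := h₁
    obtain ⟨e', b'⟩ := h₂
    simp only at hE
    subst hE
    refine hn.of_loop hG hsize (v := v) (e := e) ?_
    rw [he]
    cases b <;> cases b' <;> simp_all [Finset.pair_comm]
  · have hv1 : G.vert h₁ = v := by rw [← mem_halfEdgesAt, he]; simp
    have hw : G.vert (opp h₁) ≠ v := by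
      intro hw
      have h1 := mem_halfEdgesAt.2 hw
      rw [he, Finset.mem_insert, Finset.mem_singleton] at h1
      rcases h1 with h1 | h1
      · have := congrArg Prod.snd h1
        simp [opp] at this
      · exact hE (by rw [← h1]; rfl)
    -- If the first edge is negative, a switch at `v` makes it positive.
    rw [← hasBalancedFlow_reswitch_iff fun x => if x = v then G.sign h₁.1 else 1]
    refine hn.of_positive_series (hG.reswitch _) (by rwa [size_reswitch]) hE he ?_
    obtain ⟨e, b⟩ := h₁
    cases b
    · simp only [opp, Bool.not_false] at hw
      simp [reswitch, hv1, hw]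
    · simp only [opp, Bool.not_true] at hw
      simp [reswitch, hv1, hw]

end LowDegree

/-! ### Splitting vertices of large degree -/

section Split

variable {V : Type*} {E : Type*} (G : SignedGraph V E) (v : V) (h₁ h₂ : E × Bool)

open Classical in
/-- Move the half-edges `h₁` and `h₂` to a new vertex, and join it to `v` by a positive edge. -/
noncomputable def split : SignedGraph (Option V) (Option E) where
  vert h := match h with
    | (none, false) => none
    | (none, true) => some v
    | (some e, b) => if (e, b) = h₁ ∨ (e, b) = h₂ then none else some (G.vert (e, b))
  sign e := e.elim 1 G.sign

variable {G v h₁ h₂}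

theorem isContraction_split (hv₁ : G.vert h₁ = v) (hv₂ : G.vert h₂ = v) :
    IsContraction (G.split v h₁ h₂) G (fun x => x.getD v) some where
  inj := Option.some_injective E
  vert e b := by
    simp only [split]
    split_ifs with h
    · rcases h with rfl | rfl <;> simp [hv₁, hv₂]
    · rfl
  sign _ := rfl
  collapsed e he := by
    cases e with
    | none => exact ⟨rfl, rfl⟩
    | some e => exact absurd ⟨e, rfl⟩ he

end Split

section Split

variable {V : Type*} {E : Type*} {G : SignedGraph V E} {v : V} {h₁ h₂ : E × Bool}

theorem split_vert_some (h : E × Bool) (hh : ¬ (h = h₁ ∨ h = h₂)) :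
    (G.split v h₁ h₂).vert (some h.1, h.2) = some (G.vert h) := by
  simp only [split]
  rw [if_neg hh]

theorem split_vert_moved (h : E × Bool) (hh : h = h₁ ∨ h = h₂) :
    (G.split v h₁ h₂).vert (some h.1, h.2) = none := by
  simp only [split]
  rw [if_pos hh]

theorem moved_ne (hne : h₁ ≠ h₂) : ((some h₁.1, h₁.2) : Option E × Bool) ≠ (some h₂.1, h₂.2) := by
  intro h
  simp only [Prod.mk.injEq, Option.some.injEq] at h
  exact hne (Prod.ext h.1 h.2)

variable [Fintype E]

open Classical in
theorem halfEdgesAt_split_none : (G.split v h₁ h₂).halfEdgesAt none =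
    {(none, false), (some h₁.1, h₁.2), (some h₂.1, h₂.2)} := by
  ext ⟨e, b⟩
  rw [mem_halfEdgesAt]
  cases e with
  | none => cases b <;> simp [split]
  | some e =>
    by_cases h : (e, b) = h₁ ∨ (e, b) = h₂
    · rw [split_vert_moved (e, b) h]
      rcases h with rfl | rfl <;> simp
    · rw [split_vert_some (e, b) h]
      have h1 : (some e, b) ≠ (some h₁.1, h₁.2) := fun h1 => h (Or.inl (by
        simp only [Prod.mk.injEq, Option.some.injEq] at h1; exact Prod.ext h1.1 h1.2))
      have h2 : (some e, b) ≠ (some h₂.1, h₂.2) := fun h1 => h (Or.inr (by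
        simp only [Prod.mk.injEq, Option.some.injEq] at h1; exact Prod.ext h1.1 h1.2))
      simp [h1, h2]

theorem degree_split_none (hne : h₁ ≠ h₂) : (G.split v h₁ h₂).degree none = 3 := by
  classical
  rw [degree, halfEdgesAt_split_none, Finset.card_insert_of_notMem (by simp),
    Finset.card_pair (moved_ne hne)]

open Classical in
theorem halfEdgesAt_split_some (w : V) : (G.split v h₁ h₂).halfEdgesAt (some w) =
    (((G.halfEdgesAt w).erase h₁).erase h₂).image (fun h => (some h.1, h.2)) ∪
      if w = v then {(none, true)} else ∅ := by
  ext ⟨e, b⟩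
  rw [mem_halfEdgesAt]
  cases e with
  | none =>
    cases b
    · split_ifs <;> simp [split]
    · by_cases h : w = v
      · simp [split, h]
      · simp [split, h, eq_comm (a := v)]
  | some e =>
    have h3 : ((some e, b) : Option E × Bool) ∉ (if w = v then {(none, true)} else ∅ :
        Finset (Option E × Bool)) := by split_ifs <;> simp
    simp only [Finset.mem_union, h3, or_false, Finset.mem_image, Prod.mk.injEq, Option.some.injEq,
      Finset.mem_erase, mem_halfEdgesAt]
    by_cases h : (e, b) = h₁ ∨ (e, b) = h₂
    · rw [split_vert_moved (e, b) h]
      simp only [reduceCtorEq, false_iff, not_exists, not_and]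
      rintro ⟨e', b'⟩ ⟨h5, h6, _⟩ rfl rfl
      rcases h with h | h
      · exact h6 h
      · exact h5 h
    · rw [split_vert_some (e, b) h, Option.some.injEq]
      push Not at h
      constructor
      · intro h4
        exact ⟨(e, b), ⟨h.2, h.1, h4⟩, rfl, rfl⟩
      · rintro ⟨⟨e', b'⟩, ⟨_, _, h4⟩, rfl, rfl⟩
        exact h4

theorem degree_split_of_ne (hv₁ : G.vert h₁ = v) (hv₂ : G.vert h₂ = v) {w : V} (hw : w ≠ v) :
    (G.split v h₁ h₂).degree (some w) = G.degree w := by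
  classical
  rw [degree, halfEdgesAt_split_some, if_neg hw, Finset.union_empty, Finset.card_image_of_injective,
    Finset.erase_eq_of_notMem, Finset.erase_eq_of_notMem, degree]
  · rw [mem_halfEdgesAt, hv₁]; exact hw.symm
  · rw [Finset.mem_erase, mem_halfEdgesAt, hv₂]; exact fun h => hw.symm h.2
  · rintro ⟨e, b⟩ ⟨e', b'⟩ h
    simpa using h

theorem degree_split_self (hv₁ : G.vert h₁ = v) (hv₂ : G.vert h₂ = v) (hne : h₁ ≠ h₂) :
    (G.split v h₁ h₂).degree (some v) + 1 = G.degree v := by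
  classical
  have h1 : h₁ ∈ G.halfEdgesAt v := mem_halfEdgesAt.2 hv₁
  have h2 : h₂ ∈ (G.halfEdgesAt v).erase h₁ :=
    Finset.mem_erase.2 ⟨hne.symm, mem_halfEdgesAt.2 hv₂⟩
  rw [degree, halfEdgesAt_split_some, if_pos rfl, Finset.card_union_of_disjoint (by simp),
    Finset.card_image_of_injective, Finset.card_singleton, Finset.card_erase_add_one h2,
    Finset.card_erase_add_one h1, degree]
  rintro ⟨e, b⟩ ⟨e', b'⟩ h
  simpa using h

/-- The new edge must carry the sum of the two moved values, whence the condition `h12`. -/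
theorem HasIntFlow.split [Fintype V] {f : E → ℤ} (hf : G.IsFlow f) (h0 : ∀ e, f e ≠ 0)
    (hv₁ : G.vert h₁ = v) (hv₂ : G.vert h₂ = v) (hne : h₁ ≠ h₂)
    (h12 : G.halfValue f h₁ + G.halfValue f h₂ ≠ 0) : (G.split v h₁ h₂).HasIntFlow := by
  classical
  set f' : Option E → ℤ := fun e => e.elim (-(G.halfValue f h₁ + G.halfValue f h₂)) f with hf'
  have hnone : (G.split v h₁ h₂).flux f' {none} = 0 := by
    have key : ∀ h : E × Bool, (G.split v h₁ h₂).halfValue f' (some h.1, h.2) = G.halfValue f h :=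
      fun h => by simp [halfValue, SignedGraph.split, f']
    rw [flux_singleton_eq_sum, halfEdgesAt_split_none, Finset.sum_insert (by simp),
      Finset.sum_pair (moved_ne hne), key, key, halfValue_false]
    simp [f']
  have hC := isContraction_split (G := G) hv₁ hv₂
  refine ⟨f', fun w => ?_, fun e => ?_⟩
  · cases w with
    | none => exact hnone
    | some w =>
      have h1 := hC.flux_eq f' {w}
      have h2 : f' ∘ some = f := rfl
      rw [h2, hf w] at h1
      by_cases hw : w = v
      · have h3 : (fun x : Option V => x.getD v) ⁻¹' {w} = insert none {some w} := by
          ext x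
          cases x <;> simp [hw]
        rw [h3, flux_insert _ _ (by simp), hnone, zero_add] at h1
        exact h1.symm
      · have h3 : (fun x : Option V => x.getD v) ⁻¹' {w} = {some w} := by
          ext x
          cases x <;> simp [Ne.symm hw]
        rw [h3] at h1
        exact h1.symm
  · cases e with
    | none => exact neg_ne_zero.2 h12
    | some e => exact h0 e

end Split

theorem BalancedFlowBelow.of_four_le_degree {n : ℕ} (hn : BalancedFlowBelow.{u, v} n) {V : Type u}
    {E : Type v} [Fintype V] [Fintype E] {G : SignedGraph V E} (hG : G.HasIntFlow)
    (hsize : G.size ≤ n) {v : V} (hv : 4 ≤ G.degree v) : G.HasBalancedFlow := by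
  classical
  obtain ⟨f, hf, h0⟩ := hG
  obtain ⟨h₁, h₂, hv₁, hv₂, hne, h12⟩ : ∃ h₁ h₂ : E × Bool, G.vert h₁ = v ∧ G.vert h₂ = v ∧
      h₁ ≠ h₂ ∧ G.halfValue f h₁ + G.halfValue f h₂ ≠ 0 := by
    -- If all pairs among three half-edges had sum zero, each of the three integer values would be
    -- zero.
    obtain ⟨a, b, c, ha, hb, hc, hab, hac, hbc⟩ :=
      (Finset.two_lt_card_iff (s := G.halfEdgesAt v)).1 (by unfold degree at hv; omega)
    rw [mem_halfEdgesAt] at ha hb hc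
    by_contra! h
    have h1 := h a b ha hb hab
    have h2 := h a c ha hc hac
    have h3 := h b c hb hc hbc
    have h4 := halfValue_ne_zero (G := G) (h0 a.1)
    omega
  refine (isContraction_split hv₁ hv₂).hasBalancedFlow
    (hn _ _ _ ?_ (HasIntFlow.split hf h0 hv₁ hv₂ hne h12))
  refine lt_of_lt_of_le ?_ hsize
  rw [size, size, Fintype.sum_option, degree_split_none hne,
    ← Finset.add_sum_erase _ _ (Finset.mem_univ v), ← Finset.add_sum_erase _ _ (Finset.mem_univ v)]
  have h1 : ∑ w ∈ Finset.univ.erase v, weight ((G.split v h₁ h₂).degree (some w)) =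
      ∑ w ∈ Finset.univ.erase v, weight (G.degree w) :=
    Finset.sum_congr rfl fun w hw => by rw [degree_split_of_ne hv₁ hv₂ (Finset.ne_of_mem_erase hw)]
  have h2 := degree_split_self hv₁ hv₂ hne
  -- Each degree beyond three adds 3 to the weight, while the new cubic vertex costs only 2.
  have h3 : weight 3 + weight ((G.split v h₁ h₂).degree (some v)) < weight (G.degree v) := by
    generalize (G.split v h₁ h₂).degree (some v) = d at h2 ⊢
    generalize G.degree v = d' at hv h2 ⊢
    subst h2
    have h4 : d ≠ 0 := by omega
    simp only [weight, h4, if_false, Nat.add_eq_zero_iff, one_ne_zero, and_false]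
    norm_num
    omega
  omega

theorem BalancedFlowBelow.of_not_isCubic {n : ℕ} (hn : BalancedFlowBelow.{u, v} n) {V : Type u}
    {E : Type v} [Fintype V] [Fintype E] {G : SignedGraph V E} (hG : G.HasIntFlow)
    (hsize : G.size ≤ n) (h : ¬ G.IsCubic) : G.HasBalancedFlow := by
  obtain ⟨v, hv⟩ := not_forall.1 h
  have h1 := hG.degree_ne_one v
  by_cases h0 : G.degree v = 0
  · exact hn.of_degree_zero hG hsize h0
  by_cases h2 : G.degree v = 2
  · exact hn.of_degree_two hG hsize h2
  exact hn.of_four_le_degree hG hsize (v := v) (by omega)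

/-- In an all-positive graph the fluxes out of all vertices add up to zero, so the last one vanishes
with the others. -/
theorem IsFlow.of_forall_ne {V E A : Type*} [AddCommGroup A] [Fintype V] [Fintype E]
    {G : SignedGraph V E} (hpos : ∀ e, G.sign e = 1) {f : E → A} (w : V)
    (hf : ∀ v ≠ w, G.flux f {v} = 0) : G.IsFlow f := by
  classical
  intro v
  by_cases hv : v = w
  · have h1 : G.flux f Set.univ = 0 := flux_eq_zero_of_inside fun e _ => ⟨hpos e, by simp⟩
    rw [flux_eq_sum_singleton, Finset.sum_eq_single w (fun x _ hx => hf x hx) (by simp)] at h1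
    rwa [hv]
  · exact hf v hv

/-- A proper nonempty part or its complement in `S` is a singleton, and both would have sum zero.
This is where the bound three on cuts enters. -/
theorem sum_subset_eq_zero_iff {α A : Type*} [AddCommGroup A] {S T : Finset α} {c : α → A}
    (hS : S.card ≤ 3) (hc : ∀ a ∈ S, c a ≠ 0) (h0 : ∑ a ∈ S, c a = 0) (hT : T ⊆ S) :
    ∑ a ∈ T, c a = 0 ↔ T = ∅ ∨ T = S := by
  classical
  constructor
  · intro h
    by_contra! hne
    have h1 : 0 < T.card := Finset.card_pos.2 hne.1
    have h2 : 0 < (S \ T).card :=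
      Finset.card_pos.2 (Finset.sdiff_nonempty.2 fun h => hne.2 (hT.antisymm h))
    have h3 : (S \ T).card + T.card = S.card := Finset.card_sdiff_add_card_eq_card hT
    have h4 : ∑ a ∈ S \ T, c a = 0 := by rw [← Finset.sum_sdiff hT, h, add_zero] at h0; exact h0
    rcases (by omega : T.card = 1 ∨ (S \ T).card = 1) with h5 | h5 <;>
      obtain ⟨a, ha⟩ := Finset.card_eq_one.1 h5
    · rw [ha, Finset.sum_singleton] at h
      exact hc a (hT (by simp [ha])) h
    · rw [ha, Finset.sum_singleton] at h4
      exact hc a (Finset.sdiff_subset (by rw [ha]; simp)) h4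
  · rintro (rfl | rfl)
    · simp
    · exact h0

/-! ### Gluing along cuts with at most three half-edges -/

section Cone

variable {V : Type*} {E : Type*}

open Classical in
/-- The map that identifies all vertices outside `X`. -/
noncomputable def collapseCompl (X : Finset V) (v : V) : Option {v // v ∈ X} :=
  if h : v ∈ X then some ⟨v, h⟩ else none

theorem collapseCompl_eq_none {X : Finset V} {v : V} : collapseCompl X v = none ↔ v ∉ X := by
  simp [collapseCompl]

theorem collapseCompl_eq_some {X : Finset V} {v : V} {w : {v // v ∈ X}} :
    collapseCompl X v = some w ↔ v = w := by
  unfold collapseCompl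
  split_ifs with h
  · simp [Subtype.ext_iff]
  · simp only [false_iff]
    rintro rfl
    exact h w.2

/-- The half-edge of `G` that gives rise to a half-edge of a cone. -/
def coneProj {D : Finset E} {S : Finset (E × Bool)} (h : ({e // e ∈ D} ⊕ {h // h ∈ S}) × Bool) :
    E × Bool :=
  Sum.elim (fun e : {e // e ∈ D} => (e.1, h.2)) (fun x => x.1) h.1

variable [Fintype E]

/-- The edges of `D` together with one new vertex, to which every half-edge that leaves `X` off `D`
is joined. All edges are positive. -/
noncomputable def cone (G : SignedGraph V E) (X : Finset V) (D : Finset E) :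
    SignedGraph (Option {v // v ∈ X}) ({e // e ∈ D} ⊕ {h // h ∈ G.outHalfEdges X D}) where
  vert h := match h with
    | (.inl e, b) => collapseCompl X (G.vert (e, b))
    | (.inr h, false) => collapseCompl X (G.vert h)
    | (.inr _, true) => none
  sign _ := 1

variable {G : SignedGraph V E} {X : Finset V} {D : Finset E} {A : Type*} [AddCommGroup A]

open Classical in
theorem flux_eq_sum_outHalfEdges {f : E → A} (hf : ∀ e ∈ D, f e = 0) {Y : Set V}
    (hY : ∀ v ∈ Y, v ∈ X) :
    G.flux f Y = ∑ h ∈ G.outHalfEdges X D with G.vert h ∈ Y, G.halfValue f h := by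
  rw [flux, ← Finset.sum_filter]
  refine (Finset.sum_subset (fun h hh => ?_) fun h hh hh' => ?_).symm
  · simp only [Finset.mem_filter, Finset.mem_univ, true_and] at hh ⊢
    exact hh.2
  · simp only [Finset.mem_filter, Finset.mem_univ, true_and, mem_outHalfEdges] at hh hh'
    have : h.1 ∈ D := by
      by_contra h1
      exact hh' ⟨⟨hY _ hh, h1⟩, hh⟩
    simp [halfValue, hf _ this]

open Classical in
theorem flux_cone (F : {e // e ∈ D} ⊕ {h // h ∈ G.outHalfEdges X D} → A)
    (hD : G.PositiveInside X D) (x : {v // v ∈ X}) :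
    (G.cone X D).flux F {some x} = G.flux (fun e => if h : e ∈ D then F (.inl ⟨e, h⟩) else 0) {↑x} +
      ∑ h ∈ G.outHalfEdges X D with G.vert h = x,
        if hh : h ∈ G.outHalfEdges X D then F (.inr ⟨h, hh⟩) else 0 := by
  rw [flux_eq_sum_edges, Fintype.sum_sum_type, flux_eq_sum_edges]
  congr 1
  · refine Finset.sum_of_injOn (Subtype.val : {e // e ∈ D} → E)
      Subtype.val_injective.injOn (by simp) ?_ ?_
    · intro e _ he
      have h1 : e ∉ D := by simpa using he
      simp [h1]
    · intro e _
      simp [cone, collapseCompl_eq_some, (hD e e.2).1]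
  · rw [Finset.sum_filter, ← Finset.sum_coe_sort (G.outHalfEdges X D)]
    refine Finset.sum_congr rfl fun h _ => ?_
    simp [cone, collapseCompl_eq_some]

theorem degree_cone_some (x : {v // v ∈ X}) :
    (G.cone X D).degree (some x) = G.degree x := by
  classical
  refine Finset.card_bij' (fun h _ => coneProj h)
    (fun h hh => if h1 : h.1 ∈ D then (.inl ⟨h.1, h1⟩, h.2) else
      (.inr ⟨h, mem_outHalfEdges.2 ⟨by rw [mem_halfEdgesAt.1 hh]; exact x.2, h1⟩⟩, false))
    ?_ ?_ ?_ ?_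
  · rintro ⟨e | h, b⟩ hh
    · rw [mem_halfEdgesAt] at hh ⊢
      exact collapseCompl_eq_some.1 hh
    · rw [mem_halfEdgesAt] at hh ⊢
      cases b
      · exact collapseCompl_eq_some.1 hh
      · cases hh
  · rintro ⟨e, b⟩ hh
    rw [mem_halfEdgesAt] at hh ⊢
    split_ifs <;> simp [cone, collapseCompl_eq_some, hh]
  · rintro ⟨e | h, b⟩ hh
    · simp [coneProj, e.2]
    · have h1 := (mem_outHalfEdges.1 h.2).2
      rw [mem_halfEdgesAt] at hh
      cases b
      · simp [coneProj, h1]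
      · cases hh
  · rintro ⟨e, b⟩ hh
    dsimp only
    split_ifs <;> rfl

theorem degree_cone_none (hD : G.PositiveInside X D) :
    (G.cone X D).degree none = (G.outHalfEdges X D).card := by
  classical
  refine Finset.card_bij' (fun h _ => coneProj h)
    (fun h hh => (.inr ⟨h, hh⟩, true)) ?_ ?_ ?_ ?_
  · rintro ⟨e | h, b⟩ hh
    · rw [mem_halfEdgesAt] at hh
      exact absurd ((hD e e.2).2 b) (collapseCompl_eq_none.1 hh)
    · exact h.2
  · rintro h hh
    rw [mem_halfEdgesAt]
    rfl
  · rintro ⟨e | h, b⟩ hh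
    · rw [mem_halfEdgesAt] at hh
      exact absurd ((hD e e.2).2 b) (collapseCompl_eq_none.1 hh)
    · rw [mem_halfEdgesAt] at hh
      cases b
      · exact absurd (mem_outHalfEdges.1 h.2).1 (collapseCompl_eq_none.1 hh)
      · rfl
  · rintro h hh
    rfl

theorem HasIntFlow.cone (hD : G.PositiveInside X D) (hG : G.HasIntFlow) :
    (G.cone X D).HasIntFlow := by
  classical
  obtain ⟨f, hf, h0⟩ := hG
  refine ⟨Sum.elim (fun e => f e) (fun h => G.halfValue f h),
    IsFlow.of_forall_ne (fun _ => rfl) none fun v hv => ?_, ?_⟩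
  · obtain ⟨x, rfl⟩ := Option.ne_none_iff_exists'.1 hv
    rw [flux_cone _ hD]
    set k : E → ℤ := fun e => if e ∈ D then f e else 0 with hk
    have h2 : G.flux (k + (f - k)) {↑x} = 0 := by rw [add_sub_cancel]; exact hf x
    rw [flux_add, flux_eq_sum_outHalfEdges (X := X) (D := D)
      (f := f - k) (fun e he => by simp [hk, he]) (by simp)] at h2
    refine Eq.trans ?_ h2
    congr 1
    · refine Finset.sum_congr (by simp) fun h hh => ?_
      have h3 := (Finset.mem_filter.1 hh).1
      rw [dif_pos h3]
      exact halfValue_congr (by simp [hk, (mem_outHalfEdges.1 h3).2])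
  · rintro (e | h)
    · exact h0 e
    · exact halfValue_ne_zero (h0 _)

theorem size_cone (hD : G.PositiveInside X D) :
    (G.cone X D).size = weight (G.outHalfEdges X D).card + ∑ x ∈ X, weight (G.degree x) := by
  classical
  rw [size, Fintype.sum_option, degree_cone_none hD, ← Finset.sum_coe_sort X]
  simp only [degree_cone_some]

/-- The flow on the cone and the given `f` may disagree on the outgoing half-edges, but their values
there have the same vanishing partial sums. The counts of nowhere-zero extensions agree, and the
cone shows that they are positive. -/
theorem exists_extension_of_cone [Fintype V] [Fintype A] (hD : G.PositiveInside X D)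
    (hout : (G.outHalfEdges X D).card ≤ 3)
    {F : {e // e ∈ D} ⊕ {h // h ∈ G.outHalfEdges X D} → A} (hF : (G.cone X D).IsFlow F)
    (hF0 : ∀ e, F e ≠ 0) {f : E → A} (hf : ∀ e ∈ D, f e = 0) (hf0 : ∀ e ∉ D, f e ≠ 0)
    (hfX : G.flux f (X : Set V) = 0) :
    ∃ g : E → A, (∀ e ∉ D, g e = 0) ∧ (∀ e ∈ D, g e ≠ 0) ∧ ∀ v ∈ X, G.flux (f + g) {v} = 0 := by
  classical
  set c : E × Bool → A := fun h => if hh : h ∈ G.outHalfEdges X D then F (.inr ⟨h, hh⟩) else 0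
    with hc
  set k : E → A := fun e => if h : e ∈ D then F (.inl ⟨e, h⟩) else 0 with hk
  -- The boundary that values on `D` must have in order to cancel the values `c` on the outgoing
  -- half-edges.
  let B : (E × Bool → A) → V → A := fun c v => -∑ h ∈ G.outHalfEdges X D with G.vert h = v, c h
  have hBsum : ∀ (c : E × Bool → A) (Y : Set V),
      ∑ v with v ∈ Y, B c v = -∑ h ∈ G.outHalfEdges X D with G.vert h ∈ Y, c h := by
    intro c Y
    simp only [B, Finset.sum_neg_distrib, Finset.sum_filter (s := G.outHalfEdges X D)]
    rw [Finset.sum_comm]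
    congr 1
    refine Finset.sum_congr rfl fun h _ => ?_
    simp [Finset.sum_ite_eq]
  have hB0 : ∀ (c : E × Bool → A) (v : V), v ∉ X → B c v = 0 := by
    intro c v hv
    simp only [B, neg_eq_zero]
    rw [Finset.filter_false_of_mem, Finset.sum_empty]
    rintro h hh rfl
    exact hv (mem_outHalfEdges.1 hh).1
  have hkf : ∀ v, G.flux k {v} = B c v := by
    intro v
    by_cases hv : v ∈ X
    · have := hF (some ⟨v, hv⟩)
      rw [flux_cone F hD] at this
      exact eq_neg_of_add_eq_zero_left this
    · rw [hB0 c v hv]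
      refine flux_eq_zero_of_outside fun h hh hv' => hv ?_
      have hD' : h.1 ∈ D := by
        by_contra h1
        exact hh (by simp [hk, h1])
      rw [Set.mem_singleton_iff] at hv'
      rw [← hv']
      exact (hD _ hD').2 h.2
  have hcsum : ∑ h ∈ G.outHalfEdges X D, c h = 0 := by
    have h1 := hBsum c (X : Set V)
    simp only [← hkf] at h1
    rw [← flux_eq_sum_singleton, flux_eq_zero_of_inside, eq_comm, neg_eq_zero] at h1
    · rw [← h1]
      refine Finset.sum_congr (Finset.ext fun h => ?_) fun _ _ => rfl
      simp +contextual [mem_outHalfEdges]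
    · intro e he
      have hD' : e ∈ D := by
        by_contra h1
        exact he (by simp [hk, h1])
      exact ⟨(hD e hD').1, iff_of_true ((hD e hD').2 _) ((hD e hD').2 _)⟩
  have hfsum : ∑ h ∈ G.outHalfEdges X D, G.halfValue f h = 0 := by
    rw [flux_eq_sum_outHalfEdges (X := X) hf (by simp)] at hfX
    rw [← hfX]
    refine Finset.sum_congr (Finset.ext fun h => ?_) fun _ _ => rfl
    simp +contextual [mem_outHalfEdges]
  have hsim : ∀ Y : Set V, ∑ v with v ∈ Y, B c v = 0 ↔ ∑ v with v ∈ Y, B (G.halfValue f) v = 0 := by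
    intro Y
    rw [hBsum, hBsum, neg_eq_zero, neg_eq_zero,
      sum_subset_eq_zero_iff hout (fun h hh => ?_) hcsum (Finset.filter_subset _ _),
      sum_subset_eq_zero_iff hout (fun h hh => ?_) hfsum (Finset.filter_subset _ _)]
    · exact halfValue_ne_zero (hf0 _ (mem_outHalfEdges.1 hh).2)
    · simp only [hc, hh, dite_true]
      exact hF0 _
  have hcard := card_solutions_eq G D hsim (Finset.univ \ D) fun e he => (hD e (by simpa using he)).1
  have hkmem : k ∈ G.solutions (Finset.univ \ D) D (B c) := by
    simp only [solutions, Finset.mem_filter, Finset.mem_univ, true_and, Finset.mem_sdiff]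
    refine ⟨hkf, fun e he => by simp [hk, he], fun e he => ?_⟩
    simp only [hk, he, dite_true]
    exact hF0 _
  obtain ⟨g, hg⟩ : (G.solutions (Finset.univ \ D) D (B (G.halfValue f))).Nonempty := by
    rw [← Finset.card_pos, ← hcard, Finset.card_pos]
    exact ⟨k, hkmem⟩
  simp only [solutions, Finset.mem_filter, Finset.mem_univ, true_and, Finset.mem_sdiff] at hg
  refine ⟨g, hg.2.1, hg.2.2, fun v hv => ?_⟩
  rw [flux_add, hg.1, flux_eq_sum_outHalfEdges (X := X) hf (by simpa using hv)]
  simp [B]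

end Cone

theorem IsCubic.sum_weight {V E : Type*} [Fintype E] {G : SignedGraph V E} (hc : G.IsCubic) (X : Finset V) :
    ∑ v ∈ X, weight (G.degree v) = 2 * X.card := by
  simp only [hc _, weight]
  simp [mul_comm]

section Cut

variable {n : ℕ} {V : Type u} {E : Type v} [Fintype V] [Fintype E] {G : SignedGraph V E}
  {X : Finset V} {D : Finset E}

theorem IsCubic.size_eq (hc : G.IsCubic) : G.size = 2 * Fintype.card V := hc.sum_weight _

theorem weight_le_two {d : ℕ} (hd : d ≤ 3) : weight d ≤ 2 := by
  interval_cases d <;> simp [weight]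

/-- The flow on the cone is a hypothesis because the cone need not be smaller than `G` when `X`
misses a single vertex. -/
theorem BalancedFlowBelow.of_cone (hn : BalancedFlowBelow.{u, v} n) (hG : G.HasIntFlow)
    (hsize : G.size ≤ n) (hc : G.IsCubic) (hD : G.PositiveInside X D)
    (hout : (G.outHalfEdges X D).card ≤ 3) (hX : 2 ≤ X.card)
    (hcone : (G.cone X D).HasBalancedFlow) : G.HasBalancedFlow := by
  refine hn.of_contract hG hsize hD ?_ ?_
  · have := weight_le_two hout
    rw [hc.sum_weight]
    omega
  · obtain ⟨F, hF, hF0, -⟩ := hcone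
    intro f hf hf0 hfX
    exact exists_extension_of_cone hD hout hF hF0 hf hf0 hfX

theorem BalancedFlowBelow.of_cut (hn : BalancedFlowBelow.{u, v} n) (hG : G.HasIntFlow)
    (hsize : G.size ≤ n) (hc : G.IsCubic) (hD : G.PositiveInside X D)
    (hout : (G.outHalfEdges X D).card ≤ 3) (hX : 2 ≤ X.card)
    (hX' : X.card + 2 ≤ Fintype.card V) : G.HasBalancedFlow := by
  refine hn.of_cone hG hsize hc hD hout hX (hn _ _ _ ?_ (hG.cone hD))
  have := weight_le_two hout
  rw [size_cone hD, hc.sum_weight]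
  rw [hc.size_eq] at hsize
  omega

end Cut

section Counting

variable {V : Type*} {E : Type*} [Fintype E]

open Classical in
theorem sum_degree_eq_card (G : SignedGraph V E) (X : Finset V) :
    ∑ v ∈ X, G.degree v = (Finset.univ.filter fun h : E × Bool => G.vert h ∈ X).card := by
  rw [Finset.card_eq_sum_card_fiberwise (f := G.vert) (t := X) (by intro h; simp)]
  refine Finset.sum_congr rfl fun v hv => ?_
  rw [degree]
  congr 1
  ext h
  simp only [mem_halfEdgesAt, Finset.mem_filter, Finset.mem_univ, true_and]
  constructor
  · rintro rfl; exact ⟨hv, rfl⟩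
  · exact fun h => h.2

theorem sum_degree_eq_two_mul (G : SignedGraph V E) [Fintype V] :
    ∑ v, G.degree v = 2 * Fintype.card E := by
  classical
  rw [sum_degree_eq_card]
  simp [mul_comm]

theorem PositiveInside.card_outHalfEdges {G : SignedGraph V E} {X : Finset V} {D : Finset E}
    (hD : G.PositiveInside X D) :
    (G.outHalfEdges X D).card + 2 * D.card = ∑ v ∈ X, G.degree v := by
  classical
  have h1 : 2 * D.card = (D ×ˢ (Finset.univ : Finset Bool)).card := by
    rw [Finset.card_product]; simp [mul_comm]
  rw [sum_degree_eq_card, h1, ← Finset.card_union_of_disjoint]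
  · congr 1
    ext h
    simp only [Finset.mem_union, mem_outHalfEdges, Finset.mem_product, Finset.mem_univ, and_true,
      Finset.mem_filter, true_and]
    constructor
    · rintro (hh | hh)
      · exact hh.1
      · exact (hD _ hh).2 h.2
    · intro h; tauto
  · rw [Finset.disjoint_left]
    intro h hh hh'
    exact (mem_outHalfEdges.1 hh).2 (Finset.mem_product.1 hh').1

theorem flux_eq_flux_of_subtype {A : Type*} [AddCommGroup A] {G : SignedGraph V E} {X : Finset V}
    {D : Finset E} {K : SignedGraph X D} (hvert : ∀ e b, (K.vert (e, b) : V) = G.vert (e, b))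
    (hsign : ∀ e, K.sign e = G.sign e) (f : E → A) (x : X)
    (hf : ∀ h, G.vert h = x → f h.1 ≠ 0 → h.1 ∈ D) :
    K.flux (fun e => f e) {x} = G.flux f {(x : V)} := by
  classical
  refine Finset.sum_of_injOn (fun h => (h.1.1, h.2)) ?_ (by simp) ?_ ?_
  · rintro ⟨e, b⟩ _ ⟨e', b'⟩ _ h
    simp only [Prod.mk.injEq] at h
    exact Prod.ext (Subtype.ext h.1) h.2
  · rintro ⟨e, b⟩ _ he
    have he' : e ∉ D := fun h => he ⟨(⟨e, h⟩, b), by simp, rfl⟩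
    by_cases h0 : f e = 0
    · simp [halfValue, h0]
    · have : G.vert (e, b) ≠ x := fun h => he' (hf (e, b) h h0)
      simp [this]
  · rintro ⟨e, b⟩ _
    have h1 : K.vert (e, b) = x ↔ G.vert (e.1, b) = x := by rw [← hvert, Subtype.ext_iff]
    simp only [Set.mem_singleton_iff, h1]
    simp [halfValue, hsign]

end Counting

/-! ### Nowhere-zero solutions on a circuit -/

section Linear

variable {V : Type*} {E : Type*} [Fintype E]

/-- The boundary operator on rational functions. -/
noncomputable def fluxLinear (G : SignedGraph V E) : (E → ℚ) →ₗ[ℚ] (V → ℚ) where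
  toFun f v := G.flux f {v}
  map_add' f g := funext fun v => G.flux_add f g {v}
  map_smul' c f := funext fun v => G.flux_map (AddMonoidHom.mulLeft c) f {v}

theorem IsConnected.exists_flux_eq [Fintype V] {A : Type*} [AddCommGroup A] {G : SignedGraph V E}
    (hc : G.IsConnected) (hpos : ∀ e, G.sign e = 1) {b : V → A} (hb : ∑ v, b v = 0) :
    ∃ f : E → A, ∀ v, G.flux f {v} = b v := by
  classical
  have h1 : b ∈ G.boundaries A ∅ := by
    rw [mem_boundaries_iff fun e _ => hpos e]
    intro Y hY
    have hadj : ∀ x y, Relation.ReflTransGen G.Adj x y → (x ∈ Y ↔ y ∈ Y) := by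
      intro x y h
      induction h with
      | refl => rfl
      | tail _ hyz ih =>
        rw [ih]
        obtain ⟨⟨e, c⟩, rfl, rfl⟩ := hyz
        have := hY e (by simp)
        cases c
        · exact this
        · exact this.symm
    rcases Y.eq_empty_or_nonempty with rfl | ⟨x, hx⟩
    · simp
    · rw [← hb, Finset.filter_true_of_mem]
      exact fun y _ => (hadj x y (hc.2 x y)).1 hx
  obtain ⟨f, -, hf⟩ := h1
  exact ⟨f, hf⟩

/-- There are as many edges as vertices, and the boundary operator over `ℚ` is not surjective since
boundaries have sum zero, so a nonzero flow exists. At a vertex of degree two both half-edges carry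
the same absolute value, which is therefore constant and can be scaled to one. -/
theorem exists_unit_flow [Fintype V] {G : SignedGraph V E}
    (hc : G.IsConnected) (hpos : ∀ e, G.sign e = 1) (h2 : ∀ v, G.degree v = 2) :
    ∃ z : E → ℤ, G.IsFlow z ∧ ∀ e, z e = 1 ∨ z e = -1 := by
  classical
  have hcard : Fintype.card E = Fintype.card V := by
    have := G.sum_degree_eq_two_mul
    simp only [h2, Finset.sum_const, Finset.card_univ, smul_eq_mul] at this
    omega
  obtain ⟨v₀⟩ := hc.1
  have hninj : ¬ Function.Injective G.fluxLinear := by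
    intro hinj
    have hsurj := (LinearMap.injective_iff_surjective_of_finrank_eq_finrank
      (f := G.fluxLinear) (by simp [hcard])).1 hinj
    obtain ⟨f, hf⟩ := hsurj (Pi.single v₀ 1)
    have h1 : G.flux f Set.univ = 0 := flux_eq_zero_of_inside fun e _ => ⟨hpos e, by simp⟩
    rw [flux_eq_sum_singleton] at h1
    have h3 : ∀ v, G.flux f {v} = (Pi.single v₀ 1 : V → ℚ) v := fun v => congrFun hf v
    simp [h3] at h1
  obtain ⟨z, hz, hz0⟩ : ∃ z, G.fluxLinear z = 0 ∧ z ≠ 0 := by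
    by_contra! h
    exact hninj ((injective_iff_map_eq_zero _).2 h)
  obtain ⟨e₀, he₀⟩ := Function.ne_iff.1 hz0
  have habs : ∀ h, |G.halfValue z h| = |z h.1| := by
    rintro ⟨e, b⟩
    cases b <;> simp [hpos]
  have hloc : ∀ h h', G.vert h = G.vert h' → |z h.1| = |z h'.1| := by
    intro h h' hh
    by_cases hne : h = h'
    · rw [hne]
    have h3 : G.halfEdgesAt (G.vert h) = {h, h'} := by
      refine (Finset.eq_of_subset_of_card_le (fun x hx => ?_) ?_).symm
      · rw [mem_halfEdgesAt]
        rcases Finset.mem_insert.1 hx with rfl | hx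
        · rfl
        · rw [Finset.mem_singleton.1 hx, hh]
      · rw [Finset.card_pair hne]
        exact (h2 _).le
    have h4 : G.flux z {G.vert h} = 0 := congrFun hz (G.vert h)
    rw [flux_singleton_eq_sum, h3, Finset.sum_pair hne] at h4
    rw [← habs, ← habs, eq_neg_of_add_eq_zero_left h4, abs_neg]
  have hall : ∀ y, ∀ h, G.vert h = y → |z h.1| = |z e₀| := by
    intro y
    have := hc.2 (G.vert (e₀, false)) y
    induction this with
    | refl => exact fun h hh => hloc h _ hh
    | tail _ hyz ih =>
      obtain ⟨h', h1, h2⟩ := hyz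
      intro h hh
      rw [hloc h (opp h') (by rw [hh, h2])]
      exact ih h' h1
  have hz' : ∀ e, z e = |z e₀| * ((if 0 < z e then (1 : ℤ) else -1 : ℤ) : ℚ) := by
    intro e
    rw [← hall _ (e, false) rfl]
    split_ifs with h
    · simp [abs_of_pos h]
    · simp [abs_of_nonpos (not_lt.1 h)]
  refine ⟨fun e => if 0 < z e then 1 else -1, fun v => ?_, fun e => by dsimp only; split_ifs <;> simp⟩
  have h5 : G.flux z {v} = 0 := congrFun hz v
  have h7 := G.flux_map (AddMonoidHom.mulLeft |z e₀|)
    (fun e => ((if 0 < z e then (1 : ℤ) else -1 : ℤ) : ℚ)) {v}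
  simp only [AddMonoidHom.coe_mulLeft] at h7
  rw [funext hz', h7] at h5
  have h6 := G.flux_map (Int.castAddHom ℚ) (fun e => if 0 < z e then (1 : ℤ) else -1) {v}
  simp only [Int.coe_castAddHom] at h6
  rw [h6, mul_eq_zero] at h5
  rcases h5 with h5 | h5
  · exact absurd (abs_eq_zero.1 h5) he₀
  · exact_mod_cast h5

/-- A multiple `a` of the unit flow is added to one solution. Each edge rules out one `a`, and there
are fewer edges than elements of `A`. -/
theorem exists_nowhere_zero_of_circuit [Fintype V] {A : Type*} [AddCommGroup A] [Fintype A]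
    {G : SignedGraph V E} (hc : G.IsConnected) (hpos : ∀ e, G.sign e = 1)
    (h2 : ∀ v, G.degree v = 2) (hA : Fintype.card E < Fintype.card A) {b : V → A}
    (hb : ∑ v, b v = 0) : ∃ f : E → A, (∀ e, f e ≠ 0) ∧ ∀ v, G.flux f {v} = b v := by
  classical
  obtain ⟨g, hg⟩ := hc.exists_flux_eq hpos hb
  obtain ⟨z, hz, hz1⟩ := exists_unit_flow hc hpos h2
  obtain ⟨a, ha⟩ : ∃ a : A, a ∉ Finset.univ.image fun e => -(z e • g e) := by
    by_contra! h
    have h3 := Finset.card_le_card (fun a _ => h a : (Finset.univ : Finset A) ⊆ _)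
    have h4 := Finset.card_image_le (s := (Finset.univ : Finset E)) (f := fun e => -(z e • g e))
    simp only [Finset.card_univ] at h3 h4
    omega
  refine ⟨g + fun e => z e • a, fun e he => ha ?_, fun v => ?_⟩
  · rw [Finset.mem_image]
    refine ⟨e, Finset.mem_univ _, ?_⟩
    have h3 : g e = -(z e • a) := eq_neg_of_add_eq_zero_left he
    rw [h3]
    rcases hz1 e with h | h <;> simp [h]
  · have h5 := G.flux_map (zmultiplesHom A a) z {v}
    simp only [zmultiplesHom_apply, hz v, zero_smul] at h5
    rw [flux_add, h5, hg, add_zero]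

end Linear

/-! ### Balanced circuits of length four -/

section FourCircuit

variable {n : ℕ} {V : Type u} {E : Type v} {G : SignedGraph V E}

open Classical in
/-- Extend a switching function by `1`. -/
noncomputable def extendSwitch {X : Finset V} (s : X → ℤˣ) (v : V) : ℤˣ :=
  if h : v ∈ X then s ⟨v, h⟩ else 1

theorem extendSwitch_coe {V : Type*} {X : Finset V} (s : X → ℤˣ) (x : X) :
    extendSwitch s (x : V) = s x := by
  simp [extendSwitch]

theorem Subgraph.sign_reswitch_extendSwitch (H : G.Subgraph) {s : H.verts → ℤˣ} {e : E}
    (he : e ∈ H.edges) : (G.reswitch (extendSwitch s)).sign e =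
      (H.toSigned.reswitch s).sign ⟨e, he⟩ := by
  have h1 := fun b => extendSwitch_coe s ⟨G.vert (e, b), H.vert_mem (e, b) he⟩
  simp only at h1
  simp only [reswitch, h1]
  rfl

theorem Subgraph.sign_reswitch_eq_one (H : G.Subgraph) {s : H.verts → ℤˣ}
    (hs : ∀ e, H.toSigned.sign e =
      s (H.toSigned.vert (e, false)) * s (H.toSigned.vert (e, true))) (e : H.edges) :
    (H.toSigned.reswitch s).sign e = 1 := by
  simp only [reswitch, hs]
  exact Int.units_mul_self _

variable [Fintype V] [Fintype E]

theorem BalancedFlowBelow.of_balanced_four_circuit (hn : BalancedFlowBelow.{u, v} n)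
    (hG : G.HasIntFlow) (hsize : G.size ≤ n) (hc : G.IsCubic) (C : G.Subgraph) (hC : C.IsCircuit)
    (h4 : C.edges.card = 4) (hbal : C.toSigned.IsBalanced) : G.HasBalancedFlow := by
  classical
  obtain ⟨s, hs⟩ := hbal.exists_sign_eq
  set G' := G.reswitch (extendSwitch s) with hG'
  rw [← hasBalancedFlow_reswitch_iff (extendSwitch s)]
  set K := C.toSigned.reswitch s with hK
  have hKpos : ∀ e, K.sign e = 1 := C.sign_reswitch_eq_one hs
  have hD : G'.PositiveInside C.verts C.edges := fun e he =>
    ⟨by rw [hG', C.sign_reswitch_extendSwitch he]; exact hKpos _, fun b => C.vert_mem (e, b) he⟩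
  have hverts : C.verts.card = 4 := by
    have h1 := C.toSigned.sum_degree_eq_two_mul
    simp only [hC.2, Finset.sum_const, Finset.card_univ, Fintype.card_coe, h4, smul_eq_mul] at h1
    omega
  -- Four cubic vertices have twelve half-edges, eight of them on the circuit. The contracted vertex
  -- has weight 5, against 8 for the four vertices.
  have hout : (G'.outHalfEdges C.verts C.edges).card = 4 := by
    have h1 := hD.card_outHalfEdges
    have h2 : ∀ v, G'.degree v = 3 := hc
    simp only [h2, h4, Finset.sum_const, hverts, smul_eq_mul] at h1
    omega
  refine hn.of_contract (hG.reswitch _) (by rwa [size_reswitch]) hD ?_ fun f hf hf0 hfX => ?_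
  · rw [hout, IsCubic.sum_weight (G := G') hc, hverts]
    simp [weight]
  · have hb : ∑ x : C.verts, -G'.flux f {(x : V)} = 0 := by
      rw [Finset.sum_neg_distrib, neg_eq_zero, Finset.sum_coe_sort C.verts fun x => G'.flux f {x},
        ← hfX, flux_eq_sum_singleton]
      refine Finset.sum_congr (Finset.ext fun x => ?_) fun _ _ => rfl
      simp
    obtain ⟨g', hg'0, hg'⟩ := exists_nowhere_zero_of_circuit (G := K) hC.1 hKpos hC.2
      (by simp [h4, ZMod.card]) hb
    set g : E → ZMod 2 × ZMod 3 := fun e => if h : e ∈ C.edges then g' ⟨e, h⟩ else 0 with hg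
    refine ⟨g, fun e he => by simp [hg, he], fun e he => ?_, fun v hv => ?_⟩
    · simp only [hg, he, dite_true]
      exact hg'0 _
    · have h1 := flux_eq_flux_of_subtype (G := G') (K := K) (fun e b => rfl)
        (fun e => (C.sign_reswitch_extendSwitch e.2).symm) g ⟨v, hv⟩ (fun h _ hh => by
          by_contra h1
          exact hh (by simp [hg, h1]))
      have h2 : (fun e : C.edges => g e) = g' := by
        funext e
        simp [hg]
      rw [h2, hg'] at h1
      rw [flux_add, ← h1, add_neg_cancel]

end FourCircuit

/-! ### Negative edges, chords and small cuts -/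

section Signs

variable {V : Type*} {E : Type*}

/-- The signature is induced by a switching function. -/
def IsSwitched (G : SignedGraph V E) : Prop :=
  ∃ s : V → ℤˣ, ∀ e, G.sign e = s (G.vert (e, false)) * s (G.vert (e, true))

theorem IsSwitched.of_reswitch {G : SignedGraph V E} (s : V → ℤˣ)
    (h : (G.reswitch s).IsSwitched) : G.IsSwitched := by
  obtain ⟨t, ht⟩ := h
  refine ⟨fun v => s v * t v, fun e => ?_⟩
  have h1 := ht e
  simp only [reswitch] at h1
  have key : ∀ a b c d : ℤˣ, c * d = a * b * (a * c * (b * d)) := by decide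
  rw [← mul_left_cancel_iff (a := s (G.vert (e, false)) * s (G.vert (e, true))), h1]
  exact key _ _ _ _

theorem IsSwitched.of_sign_eq_one {G : SignedGraph V E} (h : ∀ e, G.sign e = 1) :
    G.IsSwitched := ⟨1, by simpa using h⟩

/-- If `t` induces the signs of `H + e`, then `s * t` is constant on the connected graph `H`. So `s`
also induces the sign of `e`, which is then positive after the switch. -/
theorem Subgraph.mem_unbalancedChords {G : SignedGraph V E} (H : G.Subgraph)
    (hconn : H.toSigned.IsConnected) {s : H.verts → ℤˣ}
    (hs : ∀ e, H.toSigned.sign e =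
      s (H.toSigned.vert (e, false)) * s (H.toSigned.vert (e, true))) {e : E}
    (he : ∀ b, G.vert (e, b) ∈ H.verts) (hsign : (G.reswitch (extendSwitch s)).sign e ≠ 1) :
    e ∈ H.unbalancedChords := by
  have heH : e ∉ H.edges := fun h => hsign (by
    rw [H.sign_reswitch_extendSwitch h, H.sign_reswitch_eq_one hs])
  refine ⟨⟨heH, he⟩, fun hbal => hsign ?_⟩
  obtain ⟨t, ht⟩ := hbal.exists_sign_eq
  change H.verts → ℤˣ at t
  have hadj : ∀ x y : H.verts, Relation.ReflTransGen H.toSigned.Adj x y → s x * t x = s y * t y := by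
    intro x y h
    induction h with
    | refl => rfl
    | tail _ hyz ih =>
      rw [ih]
      obtain ⟨⟨⟨e', he'⟩, c⟩, rfl, rfl⟩ := hyz
      have h1 := hs ⟨e', he'⟩
      have h2 := ht ⟨e', by simp [addChord, he']⟩
      have h3 : s (H.toSigned.vert (⟨e', he'⟩, false)) * s (H.toSigned.vert (⟨e', he'⟩, true)) =
        t (H.toSigned.vert (⟨e', he'⟩, false)) * t (H.toSigned.vert (⟨e', he'⟩, true)) :=
        h1.symm.trans h2
      have key : ∀ a b c d : ℤˣ, a * b = c * d → a * c = b * d := by decide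
      cases c
      · exact key _ _ _ _ h3
      · exact (key _ _ _ _ h3).symm
  have h2 : G.sign e = t ⟨G.vert (e, false), he _⟩ * t ⟨G.vert (e, true), he _⟩ :=
    ht ⟨e, by simp [addChord]⟩
  have h3 := hadj _ _ (hconn.2 ⟨G.vert (e, false), he _⟩ ⟨G.vert (e, true), he _⟩)
  have key : ∀ a b c d : ℤˣ, a * c = b * d → a * b * (c * d) = 1 := by decide
  simp only [reswitch]
  rw [h2, show extendSwitch s (G.vert (e, false)) = s ⟨_, he _⟩ from extendSwitch_coe s ⟨_, he _⟩,
    show extendSwitch s (G.vert (e, true)) = s ⟨_, he _⟩ from extendSwitch_coe s ⟨_, he _⟩]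
  exact key _ _ _ _ h3

theorem eq_or_eq_opp {h h' : E × Bool} (he : h.1 = h'.1) : h = h' ∨ h = opp h' := by
  obtain ⟨e, b⟩ := h
  obtain ⟨e', b'⟩ := h'
  simp only at he
  subst he
  cases b <;> cases b' <;> simp [opp]

theorem vert_mem_of_half {G : SignedGraph V E} {X : Finset V} {h : E × Bool} (h1 : G.vert h ∈ X)
    (h2 : G.vert (opp h) ∈ X) (b : Bool) : G.vert (h.1, b) ∈ X := by
  obtain ⟨e, c⟩ := h
  cases b <;> cases c <;> simpa [opp] using ‹_›

variable [Fintype E]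

open Classical in
/-- The positive edges with both ends in `X`. -/
noncomputable def positiveEdges (G : SignedGraph V E) (X : Finset V) : Finset E :=
  {e | G.sign e = 1 ∧ ∀ b, G.vert (e, b) ∈ X}

theorem mem_positiveEdges {G : SignedGraph V E} {X : Finset V} {e : E} :
    e ∈ G.positiveEdges X ↔ G.sign e = 1 ∧ ∀ b, G.vert (e, b) ∈ X := by
  simp [positiveEdges]

theorem positiveInside_positiveEdges (G : SignedGraph V E) (X : Finset V) :
    G.PositiveInside X (G.positiveEdges X) := fun _ he => mem_positiveEdges.1 he

/-- A boundary edge contributes one outgoing half-edge, a negative edge inside `X` contributes two.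
This turns the left-hand side of (S3) into a count of half-edges. -/
theorem card_outHalfEdges_le (G : SignedGraph V E) (X : Finset V) :
    (G.outHalfEdges X (G.positiveEdges X)).card ≤ (G.boundaryEdges (X : Set V)).ncard +
      2 * {e | G.sign e ≠ 1 ∧ ∀ b, G.vert (e, b) ∈ X}.ncard := by
  classical
  set S := G.outHalfEdges X (G.positiveEdges X)
  rw [← Finset.card_filter_add_card_filter_not (s := S) fun h => G.vert (opp h) ∉ X]
  refine add_le_add ?_ ?_
  · rw [← Set.ncard_coe_finset]
    refine Set.ncard_le_ncard_of_injOn Prod.fst ?_ ?_ (Set.toFinite _)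
    · rintro ⟨e, b⟩ hh
      rw [Finset.mem_coe, Finset.mem_filter, mem_outHalfEdges] at hh
      obtain ⟨⟨h1, -⟩, h2⟩ := hh
      cases b
      · exact Or.inl ⟨h1, h2⟩
      · exact Or.inr ⟨h2, h1⟩
    · intro h hh h' hh' he
      rw [Finset.mem_coe, Finset.mem_filter, mem_outHalfEdges] at hh hh'
      rcases eq_or_eq_opp he with h1 | h1
      · exact h1
      · exact absurd (h1 ▸ hh.1.1) hh'.2
  · have h1 : {e | G.sign e ≠ 1 ∧ ∀ b, G.vert (e, b) ∈ X} =
        ((Finset.univ.filter fun e => G.sign e ≠ 1 ∧ ∀ b, G.vert (e, b) ∈ X : Finset E) : Set E) := by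
      ext; simp
    rw [h1, Set.ncard_coe_finset, mul_comm, ← Fintype.card_bool, ← Finset.card_univ,
      ← Finset.card_product]
    refine Finset.card_le_card fun h hh => ?_
    rw [Finset.mem_filter, mem_outHalfEdges, not_not, mem_positiveEdges] at hh
    simp only [Finset.mem_product, Finset.mem_filter, Finset.mem_univ, true_and, and_true]
    have h2 := vert_mem_of_half hh.1.1 hh.2
    exact ⟨fun h3 => hh.1.2 ⟨h3, h2⟩, h2⟩

/-- The total flux is the sum of `2 * f e` over the negative edges; a single term cannot vanish. -/
theorem HasIntFlow.exists_ne_negative [Fintype V] {G : SignedGraph V E} (hG : G.HasIntFlow) {e : E}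
    (he : G.sign e ≠ 1) : ∃ e' ≠ e, G.sign e' ≠ 1 := by
  classical
  by_contra! h
  obtain ⟨f, hf, h0⟩ := hG
  have h1 := hf.flux_eq_zero Set.univ
  rw [flux_eq_sum_edges, Finset.sum_eq_single e (fun e' _ he' => by simp [h e' he']) (by simp)]
    at h1
  have h2 : G.sign e = -1 := (Int.units_eq_one_or _).resolve_left he
  simp only [Set.mem_univ, if_true, h2] at h1
  have := h0 e
  simp at h1
  omega

/-- The edges at `w` have total zero at `w` and also at their other ends, because the remaining
edges are positive. Comparing the two, the positive edges at `w` have sum zero, so none or all three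
are positive. In the first case a switch at `w` removes all negative edges. -/
theorem HasIntFlow.isSwitched_of_vertex [Fintype V] {G : SignedGraph V E} (hG : G.HasIntFlow) {w : V}
    (hw : G.degree w = 3) (hloop : ∀ h, G.vert h = w → G.vert (opp h) ≠ w)
    (hpos : ∀ e, (∀ b, G.vert (e, b) ≠ w) → G.sign e = 1) : G.IsSwitched := by
  classical
  obtain ⟨f, hf, h0⟩ := hG
  have h1 := hf w
  rw [flux_singleton_eq_sum] at h1
  have h2 := hf.flux_eq_zero {w}ᶜ
  have h3 : G.flux f {w}ᶜ = ∑ h ∈ G.halfEdgesAt w, G.halfValue f (opp h) := by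
    have h4 : G.flux f {w}ᶜ = ∑ h, if G.vert (opp h) ≠ w then G.halfValue f (opp h) else 0 := by
      have hinv : Function.Involutive (opp : E × Bool → E × Bool) := fun h => by simp [opp]
      rw [flux, ← Equiv.sum_comp hinv.toPerm]
      refine Finset.sum_congr rfl fun h _ => ?_
      by_cases hh : G.vert (opp h) = w <;> simp [hh]
    rw [h4, halfEdgesAt, Finset.sum_filter, ← sub_eq_zero, ← Finset.sum_sub_distrib]
    have h5 : ∀ h : E × Bool, ((if G.vert (opp h) ≠ w then G.halfValue f (opp h) else 0) -
        if G.vert h = w then G.halfValue f (opp h) else 0) =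
        if (∀ b, G.vert (h.1, b) ≠ w) then G.halfValue f (opp h) else 0 := by
      rintro ⟨e, b⟩
      have h6 := hloop (e, b)
      have h7 := hloop (e, !b)
      cases b <;> simp only [opp, Bool.not_false, Bool.not_true, Bool.forall_bool] at h6 h7 ⊢ <;>
      by_cases h8 : G.vert (e, false) = w <;> by_cases h9 : G.vert (e, true) = w <;>
        simp_all
    simp only [h5]
    rw [Fintype.sum_prod_type]
    refine Finset.sum_eq_zero fun e _ => ?_
    by_cases h6 : ∀ b, G.vert (e, b) ≠ w
    · simp [h6, opp, hpos e h6]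
    · simp only [h6, if_false, Finset.sum_const_zero]
  rw [h3] at h2
  simp only [halfValue_opp] at h2
  set T := (G.halfEdgesAt w).filter fun h => G.sign h.1 = 1 with hT
  have h4 : ∑ h ∈ T, G.halfValue f h = 0 := by
    have h5 : ∑ h ∈ G.halfEdgesAt w, (G.halfValue f h - -((G.sign h.1 : ℤ) • G.halfValue f h)) =
        ∑ h ∈ G.halfEdgesAt w, if G.sign h.1 = 1 then 2 * G.halfValue f h else 0 := by
      refine Finset.sum_congr rfl fun h _ => ?_
      rcases Int.units_eq_one_or (G.sign h.1) with hs | hs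
      · simp [hs]; ring
      · rw [hs]; simp
    rw [Finset.sum_sub_distrib, h1, h2, sub_zero, ← Finset.sum_filter, ← Finset.mul_sum] at h5
    have h6 : 2 * ∑ h ∈ T, G.halfValue f h = 0 := h5.symm
    omega
  rw [sum_subset_eq_zero_iff (S := G.halfEdgesAt w) hw.le (fun h _ => halfValue_ne_zero (h0 _)) h1
    (Finset.filter_subset _ _)] at h4
  rcases h4 with h4 | h4
  · refine ⟨fun x => if x = w then -1 else 1, fun e => ?_⟩
    have h5 : ∀ b, G.vert (e, b) = w → G.sign e = -1 := fun b hb =>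
      (Int.units_eq_one_or _).resolve_left fun h => by
        have : (e, b) ∈ T := Finset.mem_filter.2 ⟨mem_halfEdgesAt.2 hb, h⟩
        rw [hT, h4] at this
        exact Finset.notMem_empty _ this
    have h6 := hloop (e, false)
    simp only [opp, Bool.not_false] at h6
    by_cases h8 : G.vert (e, false) = w
    · simp [h8, h6 h8, h5 _ h8]
    · by_cases h9 : G.vert (e, true) = w
      · simp [h8, h9, h5 _ h9]
      · simp only [h8, h9, if_false, mul_one]
        exact hpos e fun b => by cases b <;> assumption
  · refine .of_sign_eq_one fun e => ?_
    by_cases h5 : ∀ b, G.vert (e, b) ≠ w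
    · exact hpos e h5
    · push Not at h5
      obtain ⟨b, hb⟩ := h5
      have : (e, b) ∈ T := by rw [hT, h4]; exact mem_halfEdgesAt.2 hb
      exact (Finset.mem_filter.1 this).2

theorem Subgraph.mem_edges_of_cubic {G : SignedGraph V E} (hc : G.IsCubic) (H : G.Subgraph)
    (hH : H.toSigned.IsCubic) (x : H.verts) (h : E × Bool) (hx : G.vert h = x) : h.1 ∈ H.edges := by
  classical
  have h1 : (H.toSigned.halfEdgesAt x).image (fun h => (h.1.1, h.2)) = G.halfEdgesAt (x : V) := by
    refine Finset.eq_of_subset_of_card_le (fun h hh => ?_) ?_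
    · obtain ⟨h', hh', rfl⟩ := Finset.mem_image.1 hh
      rw [mem_halfEdgesAt] at hh' ⊢
      exact congrArg Subtype.val hh'
    · rw [Finset.card_image_of_injective]
      · exact ((hc x).trans (hH x).symm).le
      · rintro ⟨e, b⟩ ⟨e', b'⟩ h
        simp only [Prod.mk.injEq] at h
        exact Prod.ext (Subtype.ext h.1) h.2
  have h2 := mem_halfEdgesAt.2 hx
  rw [← h1] at h2
  obtain ⟨h', -, rfl⟩ := Finset.mem_image.1 h2
  exact h'.1.2

/-- A cubic subgraph of a cubic graph contains every edge at its vertices, so a flow restricts to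
it. -/
theorem Subgraph.isFlowAdmissible_of_cubic {G : SignedGraph V E} (hc : G.IsCubic)
    (hG : G.HasIntFlow) (H : G.Subgraph) (hH : H.toSigned.IsCubic) :
    H.toSigned.IsFlowAdmissible := by
  obtain ⟨f, hf, h0⟩ := hG
  rw [isFlowAdmissible_iff]
  refine ⟨fun e => f e, fun x => ?_, fun e => h0 e⟩
  rw [flux_eq_flux_of_subtype (G := G) (fun _ _ => rfl) (fun _ => rfl) f x
    fun h hx _ => H.mem_edges_of_cubic hc hH x h hx]
  exact hf x

end Signs

/-! ### Unbalanced cubic graphs: reduction to shrubberies -/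

section Shrubbery

variable {n : ℕ} {V : Type u} {E : Type v} [Fintype V] [Fintype E] {G : SignedGraph V E}

/-- The all-positive case of size up to `n` is needed only in the presence of a loop. Restricting
`hloop` accordingly avoids circularity: the positive case is itself reduced to loopless unbalanced
graphs. -/
theorem BalancedFlowBelow.of_large_balanced_subgraph (hn : BalancedFlowBelow.{u, v} n)
    (hG : G.HasIntFlow) (hsize : G.size ≤ n) (hc : G.IsCubic) (hunb : ¬ G.IsSwitched)
    (hloop : (∃ e, G.vert (e, false) = G.vert (e, true)) →
      ∀ (V' : Type u) (E' : Type v) [Fintype V'] [Fintype E'] (G' : SignedGraph V' E'),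
        (∀ e, G'.sign e = 1) → G'.size ≤ n → G'.HasIntFlow → G'.HasBalancedFlow)
    {X : Finset V} (hX : 2 ≤ X.card)
    (hout : (G.outHalfEdges X (G.positiveEdges X)).card ≤ 3) : G.HasBalancedFlow := by
  classical
  have hD := G.positiveInside_positiveEdges X
  have hXV : X.card ≤ Fintype.card V := Finset.card_le_univ X
  by_cases h1 : X.card + 2 ≤ Fintype.card V
  · exact hn.of_cut hG hsize hc hD hout hX h1
  by_cases h2 : X.card = Fintype.card V
  · exfalso
    -- An unbalanced graph with a flow has at least two negative edges, giving four outgoing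
    -- half-edges.
    have hmem : ∀ v, v ∈ X := fun v => by rw [(Finset.card_eq_iff_eq_univ X).1 h2]; simp
    have hex : ∃ e, G.sign e ≠ 1 := by
      by_contra! h
      exact hunb (.of_sign_eq_one h)
    obtain ⟨e, he⟩ := hex
    obtain ⟨e', hne, he'⟩ := hG.exists_ne_negative he
    have h3 : ({e, e'} : Finset E) ×ˢ (Finset.univ : Finset Bool) ⊆
        G.outHalfEdges X (G.positiveEdges X) := by
      rintro ⟨d, b⟩ hd
      simp only [Finset.mem_product, Finset.mem_insert, Finset.mem_singleton, Finset.mem_univ,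
        and_true] at hd
      rw [mem_outHalfEdges, mem_positiveEdges]
      refine ⟨hmem _, fun h => ?_⟩
      rcases hd with rfl | rfl
      · exact he h.1
      · exact he' h.1
    have h4 := Finset.card_le_card h3
    rw [Finset.card_product, Finset.card_pair hne.symm] at h4
    simp at h4
    omega
  · obtain ⟨w, hw⟩ : ∃ w, Xᶜ = {w} := Finset.card_eq_one.1 (by rw [Finset.card_compl]; omega)
    have hmem : ∀ v, v ∈ X ↔ v ≠ w := fun v => by
      rw [← not_iff_not, ← Finset.mem_compl, hw]; simp
    by_cases hl : ∃ e, G.vert (e, false) = G.vert (e, true)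
    · refine hn.of_cone hG hsize hc hD hout hX (hloop hl _ _ _ (fun _ => rfl) ?_ (hG.cone hD))
      have := weight_le_two hout
      rw [size_cone, hc.sum_weight]
      · rw [hc.size_eq] at hsize
        omega
      · exact hD
    · push Not at hl
      have hl' : ∀ h, G.vert h = w → G.vert (opp h) ≠ w := by
        rintro ⟨e, b⟩ h1 h2
        cases b
        · exact hl e (h1.trans h2.symm)
        · exact hl e (h2.trans h1.symm)
      refine absurd (hG.isSwitched_of_vertex (hc w) hl' fun e he => ?_) hunb
      by_contra hs
      -- A negative edge `e` away from `w` would be a source of outgoing half-edges besides the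
      -- three edges at `w`.
      have h3 : insert (e, false) ((G.halfEdgesAt w).image opp) ⊆
          G.outHalfEdges X (G.positiveEdges X) := by
        intro h hh
        rw [Finset.mem_insert, Finset.mem_image] at hh
        rw [mem_outHalfEdges, mem_positiveEdges, hmem]
        rcases hh with rfl | ⟨h', hh', rfl⟩
        · exact ⟨he _, fun h => hs h.1⟩
        · rw [mem_halfEdgesAt] at hh'
          exact ⟨hl' _ hh', fun h => (hmem _).1 (h.2 h'.2) hh'⟩
      have h4 := Finset.card_le_card h3
      rw [Finset.card_insert_of_notMem, Finset.card_image_of_injective] at h4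
      · have : (G.halfEdgesAt w).card = 3 := hc w
        omega
      · exact Function.Involutive.injective fun h => by simp [opp]
      · rw [Finset.mem_image]
        rintro ⟨⟨e', b⟩, hh', h5⟩
        rw [mem_halfEdgesAt] at hh'
        have h6 : e' = e := congrArg Prod.fst h5
        exact he b (h6 ▸ hh')

theorem BalancedFlowBelow.of_shrubberies (hn : BalancedFlowBelow.{u, v} n)
    (hG : G.HasIntFlow) (hsize : G.size ≤ n) (hc : G.IsCubic) (hunb : ¬ G.IsSwitched)
    (hloop : (∃ e, G.vert (e, false) = G.vert (e, true)) →
      ∀ (V' : Type u) (E' : Type v) [Fintype V'] [Fintype E'] (G' : SignedGraph V' E'),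
        (∀ e, G'.sign e = 1) → G'.size ≤ n → G'.HasIntFlow → G'.HasBalancedFlow)
    (hshrub : G.IsShrubbery → G.HasBalancedFlow) : G.HasBalancedFlow := by
  by_contra hno
  refine hno (hshrub ⟨fun v => (hc v).le, fun H hH => H.isFlowAdmissible_of_cubic hc hG hH,
    fun H hbal hconn hX => ?_, fun C hC h4 hbal =>
      hno (hn.of_balanced_four_circuit hG hsize hc C hC h4 hbal)⟩)
  by_contra hlt
  obtain ⟨s, hs⟩ := hbal.exists_sign_eq
  refine hno ((hasBalancedFlow_reswitch_iff (extendSwitch s)).1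
    (hn.of_large_balanced_subgraph (hG.reswitch _) (by rwa [size_reswitch]) hc
      (fun h => hunb (h.of_reswitch _)) hloop hX ?_))
  refine (card_outHalfEdges_le _ _).trans ?_
  have h1 : {e | (G.reswitch (extendSwitch s)).sign e ≠ 1 ∧
      ∀ b, (G.reswitch (extendSwitch s)).vert (e, b) ∈ H.verts}.ncard ≤
      H.unbalancedChords.ncard := by
    refine Set.ncard_le_ncard (fun e he => ?_) (Set.toFinite _)
    exact H.mem_unbalancedChords hconn hs he.2 he.1
  have h2 : ∑ x ∈ H.verts, (3 - (G.degree x : ℤ)) = 0 :=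
    Finset.sum_eq_zero fun x _ => by rw [hc x]; simp
  have h3 : (G.reswitch (extendSwitch s)).boundaryEdges (H.verts : Set V) =
    G.boundaryEdges (H.verts : Set V) := rfl
  rw [h2] at hlt
  rw [h3]
  omega

end Shrubbery

/-! ### Trading two positive edges for two negative ones -/

section Flip

variable {V : Type*} {E : Type*}

open Classical in
/-- Replace the edges `e = x u` and `e' = y v` by negative edges `x y` and `u v`. All other edges
become positive. -/
noncomputable def flip (G : SignedGraph V E) (e e' : E) : SignedGraph V E where
  vert h := G.vert (Equiv.swap (e, true) (e', false) h)
  sign k := if k = e ∨ k = e' then -1 else 1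

theorem flip_vert_of_ne {G : SignedGraph V E} {e e' : E} {h : E × Bool} (h1 : h ≠ (e, true))
    (h2 : h ≠ (e', false)) : (G.flip e e').vert h = G.vert h := by
  classical
  simp [flip, Equiv.swap_apply_of_ne_of_ne h1 h2]

theorem flip_vert_left (G : SignedGraph V E) (e e' : E) :
    (G.flip e e').vert (e, true) = G.vert (e', false) := by
  simp [flip]

theorem flip_vert_right (G : SignedGraph V E) (e e' : E) :
    (G.flip e e').vert (e', false) = G.vert (e, true) := by
  simp [flip]

theorem flip_sign_left (G : SignedGraph V E) (e e' : E) : (G.flip e e').sign e = -1 := by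
  simp [flip]

theorem flip_sign_right (G : SignedGraph V E) (e e' : E) : (G.flip e e').sign e' = -1 := by
  simp [flip]

theorem flip_sign_of_ne {G : SignedGraph V E} {e e' k : E} (h1 : k ≠ e) (h2 : k ≠ e') :
    (G.flip e e').sign k = 1 := by
  simp [flip, h1, h2]

variable [Fintype E] {G : SignedGraph V E} {e e' : E}

theorem degree_flip (v : V) : (G.flip e e').degree v = G.degree v := by
  classical
  refine Finset.card_equiv (Equiv.swap (e, true) (e', false)) fun h => ?_
  rw [mem_halfEdgesAt, mem_halfEdgesAt, flip]

theorem flip_flux {A : Type*} [AddCommGroup A] (hpos : ∀ k, G.sign k = 1) (hne : e ≠ e')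
    {f g : E → A} (he : f e' = -f e) (hg : g e' = f e) (hfg : ∀ k ≠ e', g k = f k) (X : Set V) :
    G.flux g X = (G.flip e e').flux f X := by
  classical
  have hhv : ∀ h, (G.flip e e').halfValue f (Equiv.swap (e, true) (e', false) h) =
      G.halfValue g h := by
    intro h
    by_cases h1 : h = (e, true)
    · subst h1
      rw [Equiv.swap_apply_left]
      simp [hpos, hfg e hne, he]
    by_cases h2 : h = (e', false)
    · subst h2
      rw [Equiv.swap_apply_right]
      simp [hg, flip_sign_left]
    rw [Equiv.swap_apply_of_ne_of_ne h1 h2]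
    obtain ⟨k, b⟩ := h
    by_cases h3 : k = e'
    · subst h3
      cases b
      · exact absurd rfl h2
      · simp [flip_sign_right, hpos, he, hg]
    · by_cases h4 : k = e
      · subst h4
        cases b
        · simp [hfg k h3]
        · exact absurd rfl h1
      · cases b <;> simp [hfg k h3, flip_sign_of_ne h4 h3, hpos]
  rw [eq_comm, flux, flux, ← Equiv.sum_comp (Equiv.swap (e, true) (e', false))]
  refine Finset.sum_congr rfl fun h _ => ?_
  rw [hhv]
  simp [flip]

/-- The total flux gives `2 * (f e + f e') = 0`, which settles the `ℤ₃`-part of `f e' = -f e`. The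
`ℤ₂`-part is the parity condition: both negative edges lie in the support of the first component, or
neither does. Opposite values on the crossed edges are equal values on the original ones. -/
theorem HasBalancedFlow.of_flip [Fintype V] (hpos : ∀ k, G.sign k = 1) (hne : e ≠ e')
    (h : (G.flip e e').HasBalancedFlow) : G.HasBalancedFlow := by
  classical
  obtain ⟨f, hf, h0, hp⟩ := h
  have h1 : f e + f e + (f e' + f e') = 0 := by
    have h1 := hf.flux_eq_zero Set.univ
    rw [flux_eq_sum_edges, Finset.sum_eq_add e e' hne] at h1
    · simpa [flip_sign_left, flip_sign_right] using h1
    · intro k _ hk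
      simp [flip_sign_of_ne hk.1 hk.2]
    · simp
    · simp
  have h2 : (f e).1 ≠ 0 ↔ (f e').1 ≠ 0 := by
    rw [Finset.prod_filter, Finset.prod_eq_mul e e' hne] at hp
    · simp only [flip_sign_left, flip_sign_right] at hp
      by_cases h3 : (f e).1 ≠ 0 <;> by_cases h4 : (f e').1 ≠ 0
      · simp [h3, h4]
      · rw [if_pos h3, if_neg h4] at hp; exact absurd hp (by decide)
      · rw [if_neg h3, if_pos h4] at hp; exact absurd hp (by decide)
      · simp [h3, h4]
    · intro k _ hk
      simp [flip_sign_of_ne hk.1 hk.2]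
    · simp
    · simp
  have key : ∀ a b : ZMod 2 × ZMod 3, a + a + (b + b) = 0 → (a.1 ≠ 0 ↔ b.1 ≠ 0) → b = -a := by
    decide
  have h3 := key _ _ h1 h2
  refine ⟨Function.update f e' (f e), fun v => ?_, fun k => ?_, by simp [hpos]⟩
  · rw [flip_flux hpos hne h3 (by simp) fun k hk => by simp [hk]]
    exact hf v
  · by_cases hk : k = e'
    · subst hk; simpa using h0 e
    · simpa [hk] using h0 k

end Flip

/-! ### Integer flows from rational flows -/

section RationalFlows

variable {V : Type*} {E : Type*} [Fintype E]

/-- A coordinate functional that vanishes on the common kernel of the vertex fluxes is a combination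
of them. -/
theorem exists_potential [Fintype V] {G : SignedGraph V E} {d : E}
    (h : ∀ z : E → ℚ, G.IsFlow z → z d = 0) :
    ∃ c : V → ℚ, ∀ z : E → ℚ, z d = ∑ v, c v * G.flux z {v} := by
  classical
  have h1 : LinearMap.proj d ∈ Submodule.span ℚ
      (Set.range fun v : V => (LinearMap.proj v : (V → ℚ) →ₗ[ℚ] ℚ) ∘ₗ G.fluxLinear) := by
    refine mem_span_of_iInf_ker_le_ker fun z hz => ?_
    rw [Submodule.mem_iInf] at hz
    exact h z fun v => hz v
  obtain ⟨c, hc⟩ := (Submodule.mem_span_range_iff_exists_fun ℚ).1 h1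
  refine ⟨c, fun z => ?_⟩
  have h2 := LinearMap.congr_fun hc z
  simp only [LinearMap.sum_apply, LinearMap.smul_apply, LinearMap.comp_apply, LinearMap.proj_apply,
    smul_eq_mul] at h2
  exact h2.symm

open Classical in
theorem potential_eq [Fintype V] {G : SignedGraph V E} {d : E} {c : V → ℚ}
    (hc : ∀ z : E → ℚ, z d = ∑ v, c v * G.flux z {v}) (k : E) :
    (if d = k then 1 else 0) =
      c (G.vert (k, false)) - ((G.sign k : ℤ) : ℚ) * c (G.vert (k, true)) := by
  have h1 := hc (Pi.single k 1)
  rw [Pi.single_apply] at h1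
  rw [h1]
  have h2 : ∀ v, G.flux (Pi.single k (1 : ℚ)) {v} = (if G.vert (k, false) = v then 1 else 0) +
      if G.vert (k, true) = v then -((G.sign k : ℤ) : ℚ) else 0 := by
    intro v
    rw [flux_eq_sum_edges, Finset.sum_eq_single k]
    · simp
    · intro k' _ hk'
      simp [hk']
    · simp
  simp only [h2, mul_add, Finset.sum_add_distrib, mul_ite, mul_one, mul_zero, Finset.sum_ite_eq,
    Finset.mem_univ, if_true]
  ring

/-- The flow space over the infinite field `ℚ` is not a finite union of proper subspaces, so one
flow is nonzero on every edge; denominators are then cleared. -/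
theorem HasIntFlow.of_rational {G : SignedGraph V E}
    (h : ∀ d, ∃ z : E → ℚ, G.IsFlow z ∧ z d ≠ 0) : G.HasIntFlow := by
  classical
  set K := LinearMap.ker G.fluxLinear
  have h1 := Subspace.biUnion_ne_univ_of_top_notMem (k := ℚ) (E := K)
    (s := Finset.univ.image fun d : E => LinearMap.ker ((LinearMap.proj d) ∘ₗ K.subtype)) (by
      intro htop
      obtain ⟨d, -, hd⟩ := Finset.mem_image.1 htop
      obtain ⟨z, hz, hzd⟩ := h d
      have h2 : (⟨z, funext hz⟩ : K) ∈ (⊤ : Submodule ℚ K) := trivial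
      rw [← hd] at h2
      exact hzd h2)
  obtain ⟨⟨z, hz⟩, hz0⟩ := (Set.ne_univ_iff_exists_notMem _).1 h1
  have hz0' : ∀ d, z d ≠ 0 := by
    intro d hd
    refine hz0 ?_
    simp only [Set.mem_iUnion]
    exact ⟨_, Finset.mem_image_of_mem _ (Finset.mem_univ d), hd⟩
  obtain ⟨b, hb⟩ := IsLocalization.exist_integer_multiples_of_finite (nonZeroDivisors ℤ) z
  choose f hf using hb
  have hb0 : ((b : ℤ) : ℚ) ≠ 0 := by exact_mod_cast nonZeroDivisors.coe_ne_zero b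
  have hf' : ∀ e, (f e : ℚ) = (b : ℤ) * z e := fun e => by
    have := hf e
    simpa using this
  refine ⟨f, fun v => ?_, fun e he => ?_⟩
  · have h2 := G.flux_map (Int.castAddHom ℚ) f {v}
    have h3 := G.flux_map (AddMonoidHom.mulLeft ((b : ℤ) : ℚ)) z {v}
    have h4 : G.flux z {v} = 0 := congrFun hz v
    simp only [Int.coe_castAddHom, hf'] at h2
    simp only [AddMonoidHom.coe_mulLeft, h4, mul_zero] at h3
    rw [h3] at h2
    exact_mod_cast h2.symm
  · have := hf' e
    rw [he, Int.cast_zero, eq_comm, mul_eq_zero] at this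
    exact this.elim hb0 (hz0' e)

end RationalFlows

/-! ### All-positive cubic graphs without small cuts -/

section PositiveCubic

variable {V : Type*} {E : Type*} {G : SignedGraph V E}

theorem IsCubic.no_positive_loop [Fintype E] (hc : G.IsCubic) (hG : G.HasIntFlow) {e : E}
    (he : G.sign e = 1) : G.vert (e, false) ≠ G.vert (e, true) := by
  classical
  intro hl
  obtain ⟨f, hf, h0⟩ := hG
  set w := G.vert (e, false) with hw
  have h1 : (e, false) ∈ G.halfEdgesAt w := mem_halfEdgesAt.2 rfl
  have h2 : (e, true) ∈ (G.halfEdgesAt w).erase (e, false) :=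
    Finset.mem_erase.2 ⟨by simp, mem_halfEdgesAt.2 hl.symm⟩
  have h3 := hf w
  rw [flux_singleton_eq_sum, ← Finset.add_sum_erase _ _ h1, ← Finset.add_sum_erase _ _ h2,
    ← add_assoc, halfValue_false, halfValue_true, he] at h3
  obtain ⟨h, hh⟩ : ∃ h, ((G.halfEdgesAt w).erase (e, false)).erase (e, true) = {h} := by
    refine Finset.card_eq_one.1 ?_
    rw [Finset.card_erase_of_mem h2, Finset.card_erase_of_mem h1]
    have : (G.halfEdgesAt w).card = 3 := hc w
    omega
  rw [hh, Finset.sum_singleton] at h3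
  simp at h3
  exact halfValue_ne_zero (h0 _) h3

theorem mem_boundaryEdges_singleton (hloop : ∀ e, G.vert (e, false) ≠ G.vert (e, true))
    {e : E} {b : Bool} {w : V} (h : G.vert (e, b) = w) : e ∈ G.boundaryEdges {w} := by
  subst h
  cases b
  · exact Or.inl ⟨rfl, fun h => hloop e h.symm⟩
  · exact Or.inr ⟨fun h => hloop e h, rfl⟩

theorem boundaryEdges_compl (X : Set V) : G.boundaryEdges Xᶜ = G.boundaryEdges X := by
  ext e
  simp only [boundaryEdges, Set.mem_ofPred_eq, Set.mem_compl_iff, not_not]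
  tauto

theorem flip_ends_eq {e e' k : E} (h1 : k ≠ e) (h2 : k ≠ e') (b : Bool) :
    (G.flip e e').vert (k, b) = G.vert (k, b) :=
  flip_vert_of_ne (fun h => h1 (congrArg Prod.fst h)) fun h => h2 (congrArg Prod.fst h)

/-- Without loops, three distinct edges meet at `w`. They would be exactly `d`, `e`, `e'`, making
`w` a common end of `e` and `e'`. -/
theorem IsCubic.not_boundaryEdges_singleton_subset [Fintype E] (hc : G.IsCubic)
    (hloop : ∀ e, G.vert (e, false) ≠ G.vert (e, true)) {e e' d : E}
    (hdis : ∀ b b', G.vert (e, b) ≠ G.vert (e', b')) (w : V) :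
    ¬ G.boundaryEdges {w} ⊆ {d, e, e'} := by
  classical
  intro h
  have hinj : Set.InjOn Prod.fst (G.halfEdgesAt w : Set (E × Bool)) := by
    intro h1 hh1 h2 hh2 he
    rw [Finset.mem_coe, mem_halfEdgesAt] at hh1 hh2
    rcases eq_or_eq_opp he with h3 | h3
    · exact h3
    · obtain ⟨k, b⟩ := h2
      rw [h3] at hh1
      cases b
      · exact absurd (hh2.trans hh1.symm) (hloop k)
      · exact absurd (hh1.trans hh2.symm) (hloop k)
  have hsub : (G.halfEdgesAt w).image Prod.fst ⊆ {d, e, e'} := by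
    intro k hk
    obtain ⟨⟨k, b⟩, hk', rfl⟩ := Finset.mem_image.1 hk
    have := h (mem_boundaryEdges_singleton hloop (mem_halfEdgesAt.1 hk'))
    simpa using this
  have heq := Finset.eq_of_subset_of_card_le hsub (by
    rw [Finset.card_image_of_injOn hinj, show (G.halfEdgesAt w).card = 3 from hc w]
    exact Finset.card_le_three)
  have hmem : ∀ k ∈ ({d, e, e'} : Finset E), ∃ b, G.vert (k, b) = w := by
    intro k hk
    rw [← heq] at hk
    obtain ⟨⟨k, b⟩, hk', rfl⟩ := Finset.mem_image.1 hk
    exact ⟨b, mem_halfEdgesAt.1 hk'⟩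
  obtain ⟨b, hb⟩ := hmem e (by simp)
  obtain ⟨b', hb'⟩ := hmem e' (by simp)
  exact hdis b b' (hb.trans hb'.symm)

variable [Fintype V] [Fintype E]

theorem HasBalancedFlow.of_two_vertices (hc : G.IsCubic) (hpos : ∀ e, G.sign e = 1)
    (hloop : ∀ e, G.vert (e, false) ≠ G.vert (e, true)) (h2 : Fintype.card V = 2) :
    G.HasBalancedFlow := by
  classical
  obtain ⟨a, b, hab, huniv⟩ := Finset.card_eq_two.1 (Finset.card_univ (α := V) ▸ h2)
  have hor : ∀ v, v = a ∨ v = b := fun v => by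
    have := Finset.mem_univ v
    rw [huniv] at this
    simpa using this
  set f : E → ZMod 2 × ZMod 3 := fun e => if G.vert (e, false) = a then (0, 1) else -(0, 1) with hf
  have hval : ∀ h, G.halfValue f h = if G.vert h = a then (0, 1) else -(0, 1) := by
    rintro ⟨e, c⟩
    cases c
    · simp [hf]
    · have h1 := hloop e
      rcases hor (G.vert (e, false)) with h3 | h3 <;> rcases hor (G.vert (e, true)) with h4 | h4
      · exact absurd (h3.trans h4.symm) h1
      · simp [hf, hpos, h3, h4, hab.symm]
      · simp [hf, hpos, h3, h4, hab.symm]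
      · exact absurd (h3.trans h4.symm) h1
  refine ⟨f, fun v => ?_, fun e => ?_, by simp [hpos]⟩
  · rw [flux_singleton_eq_sum]
    have h3 : ∀ h ∈ G.halfEdgesAt v, G.halfValue f h =
        if v = a then ((0, 1) : ZMod 2 × ZMod 3) else -(0, 1) := fun h hh => by
      rw [hval, mem_halfEdgesAt.1 hh]
    rw [Finset.sum_congr rfl h3, Finset.sum_const, show (G.halfEdgesAt v).card = 3 from hc v]
    split_ifs <;> decide
  · simp only [hf]
    split_ifs <;> decide

theorem IsCubic.exists_disjoint_edges (hc : G.IsCubic) (h4 : 4 ≤ Fintype.card V) :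
    ∃ e e' : E, ∀ b b', G.vert (e, b) ≠ G.vert (e', b') := by
  classical
  have hE := G.sum_degree_eq_two_mul
  simp only [hc _, Finset.sum_const, Finset.card_univ, smul_eq_mul] at hE
  obtain ⟨e⟩ : Nonempty E := Fintype.card_pos_iff.1 (by omega)
  set S := G.halfEdgesAt (G.vert (e, false)) ∪ G.halfEdgesAt (G.vert (e, true)) with hS
  have hScard : S.card ≤ 6 := by
    refine (Finset.card_union_le _ _).trans ?_
    have h1 := hc (G.vert (e, false))
    have h2 := hc (G.vert (e, true))
    unfold degree at h1 h2
    omega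
  have hmem : (e, true) ∈ S := Finset.mem_union_right _ (mem_halfEdgesAt.2 rfl)
  -- The ends of `e` carry at most six half-edges, two of them on `e`, so at most five edges meet
  -- them; the graph has at least six.
  obtain ⟨e', he'⟩ : ∃ e', e' ∉ (S.erase (e, true)).image Prod.fst := by
    by_contra! h
    have h1 := Finset.card_le_card (fun a _ => h a : (Finset.univ : Finset E) ⊆ _)
    have h2 := Finset.card_image_le (s := S.erase (e, true)) (f := Prod.fst)
    rw [Finset.card_erase_of_mem hmem] at h2
    rw [Finset.card_univ] at h1
    omega
  refine ⟨e, e', fun b b' h => he' ?_⟩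
  have h1 : (e', b') ∈ S := by
    cases b
    · exact Finset.mem_union_left _ (mem_halfEdgesAt.2 h.symm)
    · exact Finset.mem_union_right _ (mem_halfEdgesAt.2 h.symm)
  rw [Finset.mem_image]
  by_cases h2 : e' = e
  · exact ⟨(e, false), Finset.mem_erase.2
      ⟨by simp, Finset.mem_union_left _ (mem_halfEdgesAt.2 rfl)⟩, h2.symm⟩
  · exact ⟨(e', b'), Finset.mem_erase.2 ⟨fun h => h2 (congrArg Prod.fst h), h1⟩, rfl⟩

/-- Sets whose boundary has at most three edges have at most one vertex inside or outside. -/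
def IsThreeConnected (G : SignedGraph V E) : Prop :=
  ∀ S : Finset V, (G.boundaryEdges (S : Set V)).ncard ≤ 3 →
    S.card ≤ 1 ∨ Fintype.card V ≤ S.card + 1

theorem IsThreeConnected.eq_empty_or_univ (h3 : G.IsThreeConnected) (hc : G.IsCubic)
    (hloop : ∀ e, G.vert (e, false) ≠ G.vert (e, true)) {e e' d : E}
    (hdis : ∀ b b', G.vert (e, b) ≠ G.vert (e', b')) {X : Set V}
    (hX : G.boundaryEdges X ⊆ {d, e, e'}) : X = ∅ ∨ X = Set.univ := by
  classical
  obtain ⟨S, rfl⟩ : ∃ S : Finset V, X = S := ⟨X.toFinite.toFinset, by simp⟩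
  have h1 : (G.boundaryEdges (S : Set V)).ncard ≤ 3 := by
    refine (Set.ncard_le_ncard hX (Set.toFinite _)).trans ?_
    have h2 : ({d, e, e'} : Set E) = (({d, e, e'} : Finset E) : Set E) := by simp
    rw [h2, Set.ncard_coe_finset]
    exact Finset.card_le_three
  rcases h3 S h1 with h2 | h2
  · rcases Nat.le_one_iff_eq_zero_or_eq_one.1 h2 with h4 | h4
    · left; simpa using h4
    · obtain ⟨w, rfl⟩ := Finset.card_eq_one.1 h4
      exact absurd (by simpa using hX) (hc.not_boundaryEdges_singleton_subset hloop hdis w)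
  · have h5 : Sᶜ.card ≤ 1 := by rw [Finset.card_compl]; omega
    rcases Nat.le_one_iff_eq_zero_or_eq_one.1 h5 with h4 | h4
    · right
      rw [Finset.card_eq_zero, Finset.compl_eq_empty_iff] at h4
      simp [h4]
    · obtain ⟨w, hw⟩ := Finset.card_eq_one.1 h4
      refine absurd ?_ (hc.not_boundaryEdges_singleton_subset hloop hdis (d := d) w)
      rw [← boundaryEdges_compl, ← Finset.coe_compl, hw] at hX
      simpa using hX

/-- A function on the vertices that takes the same value on both ends of all edges but three. -/
theorem IsThreeConnected.eq_of_forall (h3 : G.IsThreeConnected) (hc : G.IsCubic)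
    (hloop : ∀ e, G.vert (e, false) ≠ G.vert (e, true)) {e e' d : E}
    (hdis : ∀ b b', G.vert (e, b) ≠ G.vert (e', b')) {α : Type*} {c : V → α}
    (h : ∀ k, k ≠ d → k ≠ e → k ≠ e' → c (G.vert (k, false)) = c (G.vert (k, true))) (x y : V) :
    c x = c y := by
  have h1 := h3.eq_empty_or_univ hc hloop hdis (d := d) (X := {v | c v = c x}) (by
    intro k hk
    by_contra hne
    simp only [Set.mem_insert_iff, Set.mem_singleton_iff, not_or] at hne
    have h2 := h k hne.1 hne.2.1 hne.2.2
    simp only [boundaryEdges, Set.mem_ofPred_eq, h2] at hk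
    tauto)
  rcases h1 with h1 | h1
  · exact absurd (show x ∈ ({v | c v = c x} : Set V) from rfl) (by rw [h1]; simp)
  · have : y ∈ ({v | c v = c x} : Set V) := by rw [h1]; trivial
    exact this.symm

variable {e e' : E}

theorem IsThreeConnected.not_isSwitched_flip (h3 : G.IsThreeConnected) (hc : G.IsCubic)
    (hloop : ∀ e, G.vert (e, false) ≠ G.vert (e, true))
    (hdis : ∀ b b', G.vert (e, b) ≠ G.vert (e', b')) : ¬ (G.flip e e').IsSwitched := by
  rintro ⟨s, hs⟩
  have hconst := h3.eq_of_forall hc hloop hdis (d := e) (c := s) fun k h1 _ h2 => by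
    have h4 := hs k
    rw [flip_sign_of_ne h1 h2, flip_ends_eq h1 h2, flip_ends_eq h1 h2] at h4
    rw [← mul_left_cancel_iff (a := s (G.vert (k, true))), mul_comm, ← h4, Int.units_mul_self]
  have h4 := hs e
  rw [flip_sign_left, hconst _ ((G.flip e e').vert (e, true)), Int.units_mul_self] at h4
  exact absurd h4 (by decide)

/-- If every flow vanished at `d`, there would be a potential whose difference (sum, on a negative
edge) is 1 on `d` and 0 elsewhere. It agrees on the ends of all edges but `d`, `e`, `e'`, hence is a
constant `t`. Both negative edges then give `2 * t` and every positive edge gives 0, so no single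
edge can be the exception. -/
theorem IsThreeConnected.hasIntFlow_flip (h3 : G.IsThreeConnected) (hc : G.IsCubic)
    (hloop : ∀ e, G.vert (e, false) ≠ G.vert (e, true))
    (hdis : ∀ b b', G.vert (e, b) ≠ G.vert (e', b')) : (G.flip e e').HasIntFlow := by
  classical
  have hne : e ≠ e' := by
    rintro rfl
    exact hdis true true rfl
  refine HasIntFlow.of_rational fun d => ?_
  by_contra! h
  obtain ⟨c, hpot⟩ := exists_potential h
  have hc' := potential_eq hpot
  have hconst := h3.eq_of_forall hc hloop hdis (d := d) (c := c) fun k h0 h1 h2 => by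
    have h4 := hc' k
    rw [if_neg h0.symm, flip_sign_of_ne h1 h2, flip_ends_eq h1 h2, flip_ends_eq h1 h2] at h4
    simp only [Units.val_one, Int.cast_one, one_mul] at h4
    linarith
  set t := c (G.vert (e, true)) with ht
  have hct : ∀ v, c v = t := fun v => hconst v _
  have h1 := hc' e
  have h2 := hc' e'
  rw [flip_sign_left, hct, hct] at h1
  rw [flip_sign_right, hct, hct] at h2
  simp only [Units.val_neg, Units.val_one, Int.cast_neg, Int.cast_one] at h1 h2
  by_cases hde : d = e
  · rw [if_pos hde] at h1
    rw [if_neg (by rw [hde]; exact hne)] at h2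
    linarith
  · rw [if_neg hde] at h1
    by_cases hde' : d = e'
    · rw [if_pos hde'] at h2
      linarith
    · have h5 := hc' d
      rw [if_pos rfl, flip_sign_of_ne hde hde', hct, hct] at h5
      simp at h5

end PositiveCubic

/-! ### The induction -/

section Main

variable {n : ℕ} {V : Type u} {E : Type v} [Fintype V] [Fintype E] {G : SignedGraph V E}

/-- The induction hypothesis leaves only cubic graphs without small cuts. From four vertices on, the
flipped graph has the same size and is cubic, unbalanced and loopless, so the shrubbery argument
applies to it with `hloop` vacuous. -/
theorem BalancedFlowBelow.of_positive (hn : BalancedFlowBelow.{u, v} n)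
    (hshrub : ∀ (V : Type u) (E : Type v) [Fintype V] [Fintype E] (G : SignedGraph V E),
      G.IsCubic → G.IsShrubbery → G.HasBalancedFlow)
    (hpos : ∀ e, G.sign e = 1) (hsize : G.size ≤ n) (hG : G.HasIntFlow) : G.HasBalancedFlow := by
  classical
  by_cases hc : G.IsCubic
  swap
  · exact hn.of_not_isCubic hG hsize hc
  by_contra hno
  have hloop : ∀ e, G.vert (e, false) ≠ G.vert (e, true) := fun e => hc.no_positive_loop hG (hpos e)
  have h3 : G.IsThreeConnected := by
    intro S hS
    by_contra! hlt
    refine hno (hn.of_cut hG hsize hc (G.positiveInside_positiveEdges S) ?_ hlt.1 hlt.2)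
    refine (card_outHalfEdges_le _ _).trans ?_
    simpa [hpos] using hS
  by_cases h4 : 4 ≤ Fintype.card V
  · obtain ⟨e, e', hdis⟩ := hc.exists_disjoint_edges h4
    have hne : e ≠ e' := by
      rintro rfl
      exact hdis true true rfl
    have hc' : (G.flip e e').IsCubic := fun v => (degree_flip v).trans (hc v)
    have hloop' : ∀ k, (G.flip e e').vert (k, false) ≠ (G.flip e e').vert (k, true) := by
      intro k
      by_cases hk : k = e
      · subst hk
        rw [flip_vert_left, flip_vert_of_ne (by simp) (by simpa using hne)]
        exact hdis _ _
      by_cases hk' : k = e'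
      · subst hk'
        rw [flip_vert_right, flip_vert_of_ne (by simpa using hk) (by simp)]
        exact hdis _ _
      rw [flip_ends_eq hk hk', flip_ends_eq hk hk']
      exact hloop k
    refine hno (HasBalancedFlow.of_flip hpos hne (hn.of_shrubberies
      (h3.hasIntFlow_flip hc hloop hdis) ?_ hc' (h3.not_isSwitched_flip hc hloop hdis) ?_
      (hshrub V E _ hc')))
    · rw [hc'.size_eq, ← hc.size_eq]
      exact hsize
    · rintro ⟨k, hk⟩
      exact absurd hk (hloop' k)
  · have hE := G.sum_degree_eq_two_mul
    simp only [hc _, Finset.sum_const, Finset.card_univ, smul_eq_mul] at hE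
    -- Fewer than four vertices and `3 * |V| = 2 * |E|` leave only 2 or 0 vertices.
    by_cases h2 : Fintype.card V = 2
    · exact hno (.of_two_vertices hc hpos hloop h2)
    · have : IsEmpty E := Fintype.card_eq_zero_iff.1 (by omega)
      exact hno (.of_isEmpty G)

theorem balancedFlowBelow_of_shrubberies
    (hshrub : ∀ (V : Type u) (E : Type v) [Fintype V] [Fintype E] (G : SignedGraph V E),
      G.IsCubic → G.IsShrubbery → G.HasBalancedFlow) (n : ℕ) : BalancedFlowBelow.{u, v} n := by
  induction n with
  | zero => exact fun V E _ _ G h => absurd h (Nat.not_lt_zero _)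
  | succ n hn =>
    intro V E _ _ G hsize hG
    have hsize := Nat.le_of_lt_succ hsize
    by_cases hc : G.IsCubic
    swap
    · exact hn.of_not_isCubic hG hsize hc
    by_cases hs : G.IsSwitched
    · obtain ⟨s, hs⟩ := hs
      rw [← hasBalancedFlow_reswitch_iff s]
      refine hn.of_positive hshrub (fun e => ?_) hsize (hG.reswitch s)
      simp only [reswitch, hs e]
      exact Int.units_mul_self _
    · exact hn.of_shrubberies hG hsize hc hs
        (fun _ V' E' _ _ G' hpos hsize' hG' => hn.of_positive hshrub hpos hsize' hG')
        (hshrub V E G hc)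

/-- The subgraph that consists of all vertices and edges. -/
def wholeSubgraph (G : SignedGraph V E) : G.Subgraph where
  verts := Finset.univ
  edges := Finset.univ
  vert_mem _ _ := Finset.mem_univ _

theorem isContraction_wholeSubgraph : IsContraction G.wholeSubgraph.toSigned G
    Subtype.val (fun e => ⟨e, Finset.mem_univ e⟩) where
  inj _ _ h := congrArg Subtype.val h
  vert _ _ := rfl
  sign _ := rfl
  collapsed e he := absurd ⟨e.1, rfl⟩ he

theorem isContraction_wholeSubgraph_symm : IsContraction G G.wholeSubgraph.toSigned
    (fun v => ⟨v, Finset.mem_univ v⟩) Subtype.val where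
  inj := Subtype.val_injective
  vert _ _ := rfl
  sign _ := rfl
  collapsed e he := absurd ⟨⟨e, Finset.mem_univ e⟩, rfl⟩ he

theorem degree_wholeSubgraph (v : G.wholeSubgraph.verts) :
    G.wholeSubgraph.toSigned.degree v = G.degree v := by
  classical
  rw [isContraction_wholeSubgraph_symm.degree_eq, degree]
  congr 1
  ext h
  simp only [mem_halfEdgesAt, Finset.mem_filter, Finset.mem_univ, true_and, Subtype.ext_iff]
  exact and_iff_left ⟨⟨h.1, Finset.mem_univ _⟩, rfl⟩

theorem IsShrubbery.isFlowAdmissible (hG : G.IsShrubbery) (hc : G.IsCubic) :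
    G.IsFlowAdmissible := by
  have h1 := hG.cubic_flowAdmissible G.wholeSubgraph fun v => by rw [degree_wholeSubgraph]; exact hc v
  rw [isFlowAdmissible_iff] at h1 ⊢
  exact isContraction_wholeSubgraph.hasIntFlow h1

end Main

end SignedGraph

theorem mainTheorem7 :
    (∀ (V : Type u) (E : Type v) [Fintype V] [Fintype E] (G : SignedGraph V E),
        G.IsFlowAdmissible → G.AdmitsBalancedNZF) ↔
      (∀ (V : Type u) (E : Type v) [Fintype V] [Fintype E] (G : SignedGraph V E),
        G.IsCubic → G.IsShrubbery → G.AdmitsBalancedNZF) := by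
  constructor
  · intro h V E _ _ G hc hG
    exact h V E G (hG.isFlowAdmissible hc)
  · intro h V E _ _ G hG
    simp only [SignedGraph.admitsBalancedNZF_iff] at h ⊢
    exact SignedGraph.balancedFlowBelow_of_shrubberies h (G.size + 1) V E G (Nat.lt_succ_self _)
      (SignedGraph.isFlowAdmissible_iff.1 hG)
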